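/- Let $d\ge 1$, let $N_d=\binom{d+2}{2}-1$, and let $\mathbb{P}^{N_d+1}$ have homogeneous coordinates $a_{000d}$ and $a_\alpha$ ($\alpha\in\mathbb{N}^3$, $|\alpha|=d$). Let $U\subset\mathbb{P}^{N_d+1}$ be the open set where $a_{000d}\neq 0$ and at least one $a_\alpha$ is non-zero, and let $$\mathcal{Y}=\Big\{a_{000d}Z_3^d+\sum_{|\alpha|=d}a_\alpha Z_0^{\alpha_0}Z_1^{\alpha_1}Z_2^{\alpha_2}=0\Big\}\subset\mathbb{P}^3\times U,\qquad H=\{Z_3=0\}\subset\mathcal{Y}.$$ Let $p:\overline{J_2^v}(\mathcal{Y})\to\mathcal{Y}$ be the space of logarithmic $2$-jets of $(\mathcal{Y},H)$ tangent to the fibres of $\mathcal{Y}\to U$. Explicitly, $\mathcal{Y}$ is covered by the charts $Z_i\ne0$, $i=0,1,2$. Over such a chart let $z_1,z_2$ be the functions $Z_k/Z_i$ with $k\le 2$, $k\neq i$, let $z_3=Z_3/Z_i$, and normalise $a_{000d}=1$; let $P(z_1,z_2)$ be the polynomial obtained from $\sum_\alpha a_\alpha Z^\alpha$ by setting $Z_i=1$.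 Let $\xi_j^{(1)},\xi_j^{(2)}$ ($j=1,2,3$) be the logarithmic jet coordinates associated with $dz_1,dz_2,dz_3/z_3$ (for a curve outside $H$ these are $z_j',z_j''$ for $j=1,2$, and $(\log z_3)',(\log z_3)''$ for $j=3$). Then $\overline{J_2^v}(\mathcal{Y})$ is defined over the chart by $$z_3^d+P=0,\qquad d z_3^d\xi_3^{(1)}+\sum_{j\le 2}\frac{\partial P}{\partial z_j}\xi_j^{(1)}=0,$$ $$d z_3^d\xi_3^{(2)}+d^2z_3^d\big(\xi_3^{(1)}\big)^2+\sum_{j\le 2}\frac{\partial P}{\partial z_j}\xi_j^{(2)}+\sum_{j,k\le 2}\frac{\partial^2P}{\partial z_j\partial z_k}\xi_j^{(1)}\xi_k^{(1)}=0 .$$ Let $\Sigma$ be the closure in $\overline{J_2^v}(\mathcal{Y})$ of the set of jets over $Z_0\ne0$ for which $\det(\xi_j^{(i)})_{1\le i,j\le2}=0$. Then $$T_{\overline{J_2^v}(\mathcal{Y})}\otimes\mathcal{O}_{\mathbb{P}^3}(7)\otimes\mathcal{O}_{\mathbb{P}^{N_d+1}}(*)$$ is generated by its global sections on $\overline{J_2^v}(\mathcal{Y})\setminus(\Sigma\cup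 p^{-1}(H))$. That is, there is an integer $e\ge 0$, depending only on $d$, such that for every point $x$ of this set and every tangent vector $v$ of $\overline{J_2^v}(\mathcal{Y})$ at $x$ there is a global section of $T_{\overline{J_2^v}(\mathcal{Y})}\otimes\mathcal{O}_{\mathbb{P}^3}(7)\otimes\mathcal{O}_{\mathbb{P}^{N_d+1}}(e)$ over all of $\overline{J_2^v}(\mathcal{Y})$ whose value at $x$ is $v$ (in the local trivialisations of the twists). Here a global section is an algebraic one: it is given on the chart $Z_i\neq0$ by a vector field $V_i$ in the coordinates $(z_j,\xi_j^{(k)},a_\alpha)$ with polynomial coefficients, of degree at most $e$ in the affine coordinates $a_\alpha$ (pole order at most $e$ along $a_{000d}=0$), tangent to $\overline{J_2^v}(\mathcal{Y})$ (which may be singular over $H$, where tangent means annihilating the equations), and on $\overline{J_2^v}(\mathcal{Y})$ over $Z_iZ_j\ne0$ these satisfy $Z_i^7V_i=Z_j^7V_j$. In particular the $V_i$ are meromorphic vector fields on $\overline{J_2^v}(\mathcal{Y})$ whose poles in the $\mathbb{P}^3$-direction have order at most $7$. -/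

import Mathlib

open scoped LinearAlgebra.Projectivization

noncomputable section

namespace LogJets

/-! The universal family `𝒴` and its divisor `H` -/

/-- Exponents `α = (α₀, α₁, α₂) ∈ ℕ³` with `|α| = d`. -/
abbrev Idx (d : ℕ) : Type := Finset.Nat.antidiagonalTuple 3 d

/-- The ternary form `∑_{|α| = d} a_α Z^α`. -/
def form {d : ℕ} (a : Idx d → ℂ) : MvPolynomial (Fin 3) ℂ :=
  ∑ α : Idx d, MvPolynomial.C (a α) * ∏ j, MvPolynomial.X j ^ (α.1 j)

/-- The parameter space `U`. Since the coefficient `a_{000d}` of `Z₃^d` does not vanish on `U`,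
we normalise it to `1`; a point of `U` is then given by the other coefficients `a_α`, which are
not all zero. -/
abbrev Param (d : ℕ) : Type := {a : Idx d → ℂ // a ≠ 0}

/-- `𝒴 ⊂ ℙ³ × U`, with equation `Z₃^d + ∑_{|α| = d} a_α Z^α = 0`. -/
def univY (d : ℕ) : Set (ℙ ℂ (Fin 4 → ℂ) × Param d) :=
  {q | (q.1.rep 3) ^ d + MvPolynomial.eval (fun j : Fin 3 => q.1.rep j.castSucc) (form q.2.1) = 0}

/-- The divisor `H = (Z₃ = 0)` on `𝒴`. -/
def divH (d : ℕ) : Set (univY d) := {q | q.1.1.rep 3 = 0}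

/-! Logarithmic jet coordinates

No point of `𝒴` has `Z₀ = Z₁ = Z₂ = 0`, so `𝒴` is covered by the charts `Z_i ≠ 0`, `i = 0, 1, 2`.
On the chart `Z_i ≠ 0` the bundle of vertical logarithmic 2-jets of `(ℙ³ × U, Z₃ = 0)` is
trivialised by `dw₁, dw₂, dw₃ / w₃`, where `w₁, w₂` are the two functions `Z_k / Z_i`
(`k ≤ 2`, `k ≠ i`, in increasing order) and `w₃ = Z₃ / Z_i`. -/

/-- Names of the coordinates on the vertical logarithmic 2-jets over the chart `Z_i ≠ 0`:
* `w 0 k` is the affine coordinate `w_k` itself, `w 1 k` and `w 2 k` are the jet coordinates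
  `ξ_k^{(1)}` and `ξ_k^{(2)}` (for a curve: the first and second derivatives of `w_k`);
* `l 0` is `w₃`, `l 1` and `l 2` are the logarithmic jet coordinates `ξ_3^{(1)}`, `ξ_3^{(2)}`
  (for a curve outside `w₃ = 0`: the derivatives `(log w₃)'` and `(log w₃)''`);
* `a α` is the coefficient `a_α`. -/
inductive Coord (d : ℕ) : Type
  | w (o : Fin 3) (k : Fin 2)
  | l (o : Fin 3)
  | a (α : Idx d)
  deriving DecidableEq, Fintype

variable {d : ℕ}

/-- The coefficients `a_α` of a point of the chart. -/
def coeffs (x : Coord d → ℂ) : Idx d → ℂ := fun α => x (.a α)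

/-- In the chart `Z_i ≠ 0`: the derivative of order `o` of `(Z₀, Z₁, Z₂)`, normalised by
`Z_i = 1` along the jet. -/
def homJet (i : Fin 3) (x : Coord d → ℂ) (o : Fin 3) : Fin 3 → ℂ :=
  Fin.insertNth (α := fun _ => ℂ) i (if o = 0 then 1 else 0) (fun k : Fin 2 => x (.w o k))

/-- The 2-jet `(f/g, (f/g)', (f/g)'')` of a quotient, from those of `f` and `g`. -/
def quotJet (f g : Fin 3 → ℂ) : Fin 3 → ℂ :=
  ![f 0 / g 0,
    f 1 / g 0 - f 0 * g 1 / g 0 ^ 2,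
    f 2 / g 0 - 2 * f 1 * g 1 / g 0 ^ 2 - f 0 * g 2 / g 0 ^ 2 + 2 * f 0 * g 1 ^ 2 / g 0 ^ 3]

/-- The logarithmic 2-jet `(f/g, (log (f/g))', (log (f/g))'')`, from the logarithmic 2-jet
`(f, (log f)', (log f)'')` and the ordinary 2-jet `(g, g', g'')`. -/
def quotLogJet (f g : Fin 3 → ℂ) : Fin 3 → ℂ :=
  ![f 0 / g 0, f 1 - g 1 / g 0, f 2 - (g 2 / g 0 - (g 1 / g 0) ^ 2)]

/-- The change of coordinates from the chart `Z_i ≠ 0` to the chart `Z_j ≠ 0`, meaningful where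
`Z_j / Z_i = homJet i x 0 j` does not vanish. -/
def transition (d : ℕ) (i j : Fin 3) (x : Coord d → ℂ) : Coord d → ℂ
  | .w o k => quotJet (fun o' => homJet i x o' (j.succAbove k)) (fun o' => homJet i x o' j) o
  | .l o => quotLogJet (fun o' => x (.l o')) (fun o' => homJet i x o' j) o
  | .a α => x (.a α)

/-! The manifold of vertical logarithmic 2-jets of `(𝒴, H)` -/

/-- The three equations of the vertical logarithmic 2-jets of `𝒴` in the chart `Z_i ≠ 0`: the
equation `w₃^d + P_a = 0` of `𝒴`, where `P_a` is the form restricted to `Z_i = 1`, and its first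
and second derivatives along a jet on which `a` is constant, in logarithmic jet coordinates. -/
def eqns (d : ℕ) (i : Fin 3) (x : Coord d → ℂ) : Fin 3 → ℂ :=
  let P := form (coeffs x)
  let Z := homJet i x 0
  let Z' := homJet i x 1
  let Z'' := homJet i x 2
  ![x (.l 0) ^ d + MvPolynomial.eval Z P,
    d * x (.l 0) ^ d * x (.l 1) + ∑ j, MvPolynomial.eval Z (MvPolynomial.pderiv j P) * Z' j,
    d * x (.l 0) ^ d * x (.l 2) + d ^ 2 * x (.l 0) ^ d * x (.l 1) ^ 2
      + ∑ j, MvPolynomial.eval Z (MvPolynomial.pderiv j P) * Z'' j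
      + ∑ j, ∑ k, MvPolynomial.eval Z (MvPolynomial.pderiv j (MvPolynomial.pderiv k P))
          * Z' j * Z' k]

/-- The part of the log jet space over the chart `Z_i ≠ 0`. -/
def jetChart (d : ℕ) (i : Fin 3) : Set (Coord d → ℂ) :=
  {x | coeffs x ≠ 0 ∧ eqns d i x = 0}

/-- Two points of charts are identified when the change of coordinates takes one to the other. -/
def Glue (d : ℕ) (p q : Σ i : Fin 3, jetChart d i) : Prop :=
  homJet p.1 p.2.1 0 q.1 ≠ 0 ∧ q.2.1 = transition d p.1 q.1 p.2.1

/-- The space of vertical logarithmic 2-jets of `(𝒴, H)`, glued from its three charts, with the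
quotient topology. -/
def LogJetSpace (d : ℕ) : Type := Quot (Glue d)

instance (d : ℕ) : TopologicalSpace (LogJetSpace d) :=
  inferInstanceAs (TopologicalSpace (Quot (Glue d)))

/-- The point of the log jet space with given coordinates in the chart `Z_i ≠ 0`. -/
def ofChart (i : Fin 3) (x : jetChart d i) : LogJetSpace d := Quot.mk _ ⟨i, x⟩

/-- Homogeneous coordinates of the base point in `ℙ³` of a log jet. -/
def homPt (i : Fin 3) (x : Coord d → ℂ) : Fin 4 → ℂ :=
  Fin.snoc (α := fun _ => ℂ) (homJet i x 0) (x (.l 0))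

theorem homJet_zero_self (i : Fin 3) (x : Coord d → ℂ) : homJet i x 0 i = 1 := by
  simp [homJet]

theorem homPt_castSucc (i : Fin 3) (x : Coord d → ℂ) (j : Fin 3) :
    homPt i x j.castSucc = homJet i x 0 j := by
  simp only [homPt, Fin.snoc_castSucc]

theorem homPt_three (i : Fin 3) (x : Coord d → ℂ) : homPt i x 3 = x (.l 0) := by
  have h := Fin.snoc_last (α := fun _ : Fin 4 => ℂ) (x (.l 0)) (homJet i x 0)
  exact h

theorem homPt_ne_zero (i : Fin 3) (x : Coord d → ℂ) : homPt i x ≠ 0 := by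
  intro h
  have h1 := congrFun h i.castSucc
  rw [homPt_castSucc, homJet_zero_self] at h1
  exact one_ne_zero h1

theorem homJet_transition (i j : Fin 3) (x : Coord d → ℂ) (h : homJet i x 0 j ≠ 0) (k : Fin 3) :
    homJet j (transition d i j x) 0 k = homJet i x 0 k / homJet i x 0 j := by
  rcases Fin.eq_self_or_eq_succAbove j k with rfl | ⟨k, rfl⟩
  · rw [homJet_zero_self, div_self h]
  · simp [homJet, transition, quotJet]

theorem homPt_transition (i j : Fin 3) (x : Coord d → ℂ) (h : homJet i x 0 j ≠ 0) :
    (homJet i x 0 j) • homPt j (transition d i j x) = homPt i x := by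
  funext k
  rcases Fin.eq_castSucc_or_eq_last k with ⟨k, rfl⟩ | rfl
  · rw [Pi.smul_apply, homPt_castSucc, homPt_castSucc, homJet_transition i j x h, smul_eq_mul,
      mul_div_cancel₀ _ h]
  · change homJet i x 0 j • homPt j _ 3 = homPt i x 3
    rw [homPt_three, homPt_three, smul_eq_mul]
    simp [transition, quotLogJet, mul_div_cancel₀ _ h]

theorem eval_form_smul (a : Idx d → ℂ) (t : ℂ) (Z : Fin 3 → ℂ) :
    MvPolynomial.eval (t • Z) (form a) = t ^ d * MvPolynomial.eval Z (form a) := by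
  simp only [form, map_sum, map_mul, map_prod, map_pow, MvPolynomial.eval_C, MvPolynomial.eval_X,
    Finset.mul_sum]
  refine Finset.sum_congr rfl fun α _ => ?_
  have hα : ∑ j, α.1 j = d := Finset.Nat.mem_antidiagonalTuple.1 α.2
  have h1 : ∏ j, (t • Z) j ^ α.1 j = t ^ d * ∏ j, Z j ^ α.1 j := by
    have h2 : t ^ d = ∏ j, t ^ α.1 j := by rw [Finset.prod_pow_eq_pow_sum, hα]
    rw [h2, ← Finset.prod_mul_distrib]
    simp [mul_pow]
  rw [h1]
  ring

/-- The base point in `𝒴` of a log jet given in a chart. -/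
def projChart (i : Fin 3) (x : jetChart d i) : univY d :=
  ⟨(Projectivization.mk ℂ (homPt i x.1) (homPt_ne_zero i x.1), ⟨coeffs x.1, x.2.1⟩), by
    obtain ⟨t, ht⟩ := Projectivization.exists_smul_eq_mk_rep ℂ (homPt i x.1) (homPt_ne_zero i x.1)
    have h0 : x.1 (.l 0) ^ d + MvPolynomial.eval (homJet i x.1 0) (form (coeffs x.1)) = 0 :=
      congrFun x.2.2 0
    change (Projectivization.mk ℂ (homPt i x.1) (homPt_ne_zero i x.1)).rep 3 ^ d +
      MvPolynomial.eval (fun j : Fin 3 =>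
        (Projectivization.mk ℂ (homPt i x.1) (homPt_ne_zero i x.1)).rep j.castSucc)
        (form (coeffs x.1)) = 0
    rw [← ht]
    have h2 : (fun j : Fin 3 => (t • homPt i x.1) j.castSucc) = (t : ℂ) • homJet i x.1 0 := by
      funext j
      change (t : ℂ) * homPt i x.1 j.castSucc = (t : ℂ) * homJet i x.1 0 j
      rw [homPt_castSucc]
    have h3 : (t • homPt i x.1) 3 = (t : ℂ) * x.1 (.l 0) := by
      change (t : ℂ) * homPt i x.1 3 = _
      rw [homPt_three]
    rw [h2, h3, eval_form_smul, mul_pow, ← mul_add, h0, mul_zero]⟩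

/-- The natural projection `p` from the log jet space to `𝒴`. -/
def proj (d : ℕ) : LogJetSpace d → univY d :=
  Quot.lift (fun q => projChart q.1 q.2) (by
    rintro ⟨i, x⟩ ⟨j, y⟩ ⟨h, hy⟩
    apply Subtype.ext
    refine Prod.ext ?_ (Subtype.ext ?_)
    · refine (Projectivization.mk_eq_mk_iff' ℂ _ _ _ _).2 ⟨homJet i x.1 0 j, ?_⟩
      change _ • homPt j y.1 = homPt i x.1
      have hy' : y.1 = transition d i j x.1 := hy
      rw [hy', homPt_transition i j x.1 h]
    · have hy' : y.1 = transition d i j x.1 := hy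
      change coeffs x.1 = coeffs y.1
      rw [hy']
      rfl)

/-- The Wronskian `det (ξ_k^{(o)})`, `1 ≤ k, o ≤ 2`, in a chart. -/
def wronskian (x : Coord d → ℂ) : ℂ :=
  x (.w 1 0) * x (.w 2 1) - x (.w 1 1) * x (.w 2 0)

/-- `Σ`: the closure in the log jet space of the locus, over the chart `Z₀ ≠ 0`, where the
Wronskian vanishes. -/
def wronskianLocus (d : ℕ) : Set (LogJetSpace d) :=
  closure {q | ∃ x : jetChart d 0, q = ofChart 0 x ∧ wronskian x.1 = 0}

/-! The tangent sheaf and its twists -/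

/-- The (Zariski) tangent space of the log jet space at a point of the chart `Z_i ≠ 0`, in the
coordinates of this chart: the kernel of the differential of the equations. -/
def tangentSpace (i : Fin 3) (x : Coord d → ℂ) : Submodule ℂ (Coord d → ℂ) :=
  LinearMap.ker (fderiv ℂ (eqns d i) x).toLinearMap

/-- A global algebraic section over the log jet space of the tangent sheaf twisted by
`𝒪_{ℙ³}(c)` and `𝒪(e)` of the parameter space.

It is given by a vector field `V_i` with polynomial coefficients in each chart, tangent to the log
jet space, such that the `V_i ⊗ Z_i^c` agree on the overlaps. In particular, `V_0` is a meromorphic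
vector field whose only poles, of order at most `c`, are along `Z₀ = 0`. The parameter space `U` is
contained in `a_{000d} ≠ 0`, where `𝒪(e)` is trivialised by `a_{000d}^e`; we require that the
coefficients have order of pole at most `e` along `a_{000d} = 0`, that is, degree at most `e` in the
affine coordinates `a_α`. -/
structure GlobalSection (d c e : ℕ) where
  /-- The components of the vector field `V_i`. -/
  field : Fin 3 → Coord d → MvPolynomial (Coord d) ℂ
  tangent : ∀ (i : Fin 3), ∀ x ∈ jetChart d i,
    (fun k => MvPolynomial.eval x (field i k)) ∈ tangentSpace i x
  compat : ∀ (i j : Fin 3), ∀ x ∈ jetChart d i, homJet i x 0 j ≠ 0 →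
    fderiv ℂ (transition d i j) x (fun k => MvPolynomial.eval x (field i k)) =
      (homJet i x 0 j) ^ c •
        (fun k => MvPolynomial.eval (transition d i j x) (field j k))
  degree_le : ∀ (i : Fin 3) (k : Coord d), ∀ m ∈ (field i k).support, ∑ α, m (.a α) ≤ e

/-- The value of a section at a point of the chart `Z_i ≠ 0`, in the trivialisation of the twists
by `Z_i^c` and `a_{000d}^e`. -/
def GlobalSection.value {c e : ℕ} (s : GlobalSection d c e) (i : Fin 3) (x : Coord d → ℂ) :
    Coord d → ℂ :=
  fun k => MvPolynomial.eval x (s.field i k)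

end LogJets

end

/-! The group `GL₃` acting on `(Z₀, Z₁, Z₂)` preserves `𝒴` once it also acts on the coefficients
`a_α`, so its Lie algebra gives vector fields on the log jet space. Where the Wronskian does not
vanish the 2-jet of `(Z₀, Z₁, Z₂)` is a basis, and an infinitesimal linear substitution can move it
in any direction; as `Z₃` is left fixed, the homogeneous scaling of the jet then realises any
variation of the logarithmic jet of `Z₃` where `Z₃ ≠ 0`. Subtracting such a field from a given
tangent vector leaves a variation of the `a_α` alone, that is, a form of degree `d` vanishing along
the 2-jet of `(Z₀ : Z₁ : Z₂)`. These forms are spanned by multiples of products of three linear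
forms vanishing at the base point, and by multiples of products of two of them corrected by a
multiple of the tangent line; cleared of denominators, both families depend polynomially on the jet
with weight `7`.

The locus `Σ` is defined as a closure from the chart `Z₀ ≠ 0`. A jet over `Z₀ = 0` with vanishing
Wronskian lies in it because the shears `Z₀ ↦ Z₀ + s Z_i` move it into that chart without changing
its Wronskian. -/

noncomputable section

namespace LogJets

open MvPolynomial

variable {d : ℕ}

/-- The ring of 2-jets of curves with values in `R`. The components are the derivatives
`(f, f', f'')`, without the factors `1 / o!` of the Taylor coefficients. -/
@[ext]
structure Jet (R : Type*) where
  der : Fin 3 → R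

namespace Jet

theorem ext_three {R : Type*} {f g : Jet R} (h₀ : f.der 0 = g.der 0) (h₁ : f.der 1 = g.der 1)
    (h₂ : f.der 2 = g.der 2) : f = g :=
  Jet.ext <| funext fun o => by fin_cases o <;> assumption

section Ring

variable {R : Type*} [CommRing R]

instance : Zero (Jet R) := ⟨⟨0⟩⟩
instance : One (Jet R) := ⟨⟨![1, 0, 0]⟩⟩
instance : Add (Jet R) := ⟨fun f g => ⟨f.der + g.der⟩⟩
instance : Neg (Jet R) := ⟨fun f => ⟨-f.der⟩⟩
instance : SMul R (Jet R) := ⟨fun r f => ⟨r • f.der⟩⟩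
instance : Mul (Jet R) :=
  ⟨fun f g => ⟨![f.der 0 * g.der 0, f.der 0 * g.der 1 + f.der 1 * g.der 0,
    f.der 0 * g.der 2 + 2 * (f.der 1 * g.der 1) + f.der 2 * g.der 0]⟩⟩

@[simp] theorem der_zero : (0 : Jet R).der = 0 := rfl
@[simp] theorem der_one : (1 : Jet R).der = ![1, 0, 0] := rfl
@[simp] theorem der_add (f g : Jet R) : (f + g).der = f.der + g.der := rfl
@[simp] theorem der_neg (f : Jet R) : (-f).der = -f.der := rfl
@[simp] theorem der_smul (r : R) (f : Jet R) : (r • f).der = r • f.der := rfl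

@[simp] theorem der_mul (f g : Jet R) : (f * g).der =
    ![f.der 0 * g.der 0, f.der 0 * g.der 1 + f.der 1 * g.der 0,
      f.der 0 * g.der 2 + 2 * (f.der 1 * g.der 1) + f.der 2 * g.der 0] := rfl

instance : CommRing (Jet R) where
  add_assoc f g h := Jet.ext (add_assoc _ _ _)
  zero_add f := Jet.ext (zero_add _)
  add_zero f := Jet.ext (add_zero _)
  add_comm f g := Jet.ext (add_comm _ _)
  neg_add_cancel f := Jet.ext (neg_add_cancel _)
  left_distrib f g h := by
    apply ext_three <;> simp only [der_mul, der_add, Pi.add_apply, Matrix.cons_val] <;> ring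
  right_distrib f g h := by
    apply ext_three <;> simp only [der_mul, der_add, Pi.add_apply, Matrix.cons_val] <;> ring
  zero_mul f := by apply ext_three <;> simp
  mul_zero f := by apply ext_three <;> simp
  mul_assoc f g h := by apply ext_three <;> simp only [der_mul, Matrix.cons_val] <;> ring
  one_mul f := by apply ext_three <;> simp
  mul_one f := by apply ext_three <;> simp
  mul_comm f g := by apply ext_three <;> simp only [der_mul, Matrix.cons_val] <;> ring
  nsmul := nsmulRec
  zsmul := zsmulRec

@[simp] theorem der_sub (f g : Jet R) : (f - g).der = f.der - g.der := by
  rw [sub_eq_add_neg, der_add, der_neg, sub_eq_add_neg]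

instance : Algebra R (Jet R) where
  algebraMap :=
    { toFun := fun r => ⟨![r, 0, 0]⟩
      map_one' := rfl
      map_zero' := by apply ext_three <;> simp
      map_add' := fun r s => by apply ext_three <;> simp
      map_mul' := fun r s => by apply ext_three <;> simp }
  commutes' r f := mul_comm _ _
  smul_def' r f := by apply ext_three <;> simp

@[simp] theorem der_algebraMap (r : R) : (algebraMap R (Jet R) r).der = ![r, 0, 0] := rfl

/-- The derivative of order `o` as a linear form on jets. -/
def derₗ (o : Fin 3) : Jet R →ₗ[R] R where
  toFun f := f.der o
  map_add' _ _ := rfl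
  map_smul' _ _ := rfl

theorem der_sum {ι : Type*} (s : Finset ι) (f : ι → Jet R) (o : Fin 3) :
    (∑ i ∈ s, f i).der o = ∑ i ∈ s, (f i).der o :=
  map_sum (derₗ o) f s

/-- The jet of `w`, from the logarithmic jet `(w, (log w)', (log w)'')`. -/
def exp (l : Fin 3 → R) : Jet R := ⟨![l 0, l 0 * l 1, l 0 * (l 2 + l 1 ^ 2)]⟩

theorem exp_pow (l : Fin 3 → R) (n : ℕ) :
    exp l ^ n = exp ![l 0 ^ n, n * l 1, n * l 2] := by
  induction n with
  | zero => apply ext_three <;> simp [exp]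
  | succ n ih =>
    rw [pow_succ, ih]
    apply ext_three <;>
      simp only [exp, der_mul, Matrix.cons_val, Nat.cast_add, Nat.cast_one] <;> ring

end Ring

end Jet

section Polynomials

variable {R σ : Type*} [CommRing R]

theorem mkDerivation_eq_sum [Fintype σ] (F : σ → MvPolynomial σ R) (p : MvPolynomial σ R) :
    mkDerivation R F p = ∑ k, F k * pderiv k p := by
  classical
  induction p using MvPolynomial.induction_on with
  | C r => simp [derivation_C]
  | add p q hp hq => simp only [map_add, hp, hq, mul_add, Finset.sum_add_distrib]
  | mul_X p k hp =>
    simp [Derivation.leibniz, hp, mkDerivation_X, pderiv_X, Pi.single_apply, mul_add,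
      Finset.sum_add_distrib, Finset.mul_sum, mul_left_comm, mul_comm]

theorem aeval_mul_of_isHomogeneous {A : Type*} [CommRing A] [Algebra R A] {p : MvPolynomial σ R}
    {n : ℕ} (hp : p.IsHomogeneous n) (g : A) (z : σ → A) :
    aeval (fun k => g * z k) p = g ^ n * aeval z p := by
  rw [aeval_def, aeval_def, eval₂_eq, eval₂_eq, Finset.mul_sum]
  refine Finset.sum_congr rfl fun m hm => ?_
  have hg : ∏ k ∈ m.support, g ^ m k = g ^ n := by
    rw [Finset.prod_pow_eq_pow_sum, ← Finsupp.degree_apply,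
      Finsupp.degree_eq_weight_one]
    exact congrArg (g ^ ·) (hp (mem_support_iff.1 hm))
  simp only [mul_pow, Finset.prod_mul_distrib, hg]
  ring

end Polynomials

namespace Jet

section ChainRule

variable {R σ : Type*} [CommRing R] (z : σ → Jet R) (p : MvPolynomial σ R)

theorem der_zero_aeval : (aeval z p).der 0 = eval (fun k => (z k).der 0) p := by
  induction p using MvPolynomial.induction_on with
  | C r => simp
  | add p q hp hq => simp [hp, hq]
  | mul_X p k hp => simp [hp]

theorem der_one_aeval : (aeval z p).der 1 =
    eval (fun k => (z k).der 0) (mkDerivation R (fun k => C ((z k).der 1)) p) := by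
  induction p using MvPolynomial.induction_on with
  | C r => simp
  | add p q hp hq => simp [hp, hq]
  | mul_X p k hp =>
    simp [hp, der_zero_aeval, Derivation.leibniz, mkDerivation_X, mul_comm, add_comm]

theorem der_two_aeval : (aeval z p).der 2 =
    eval (fun k => (z k).der 0) (mkDerivation R (fun k => C ((z k).der 2)) p +
      mkDerivation R (fun k => C ((z k).der 1)) (mkDerivation R (fun k => C ((z k).der 1)) p)) := by
  induction p using MvPolynomial.induction_on with
  | C r => simp
  | add p q hp hq =>
    simp only [map_add, der_add, Pi.add_apply, hp, hq]
    ring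
  | mul_X p k hp =>
    simp only [map_mul, aeval_X, der_mul, Matrix.cons_val, hp, der_zero_aeval, der_one_aeval,
      Derivation.leibniz, mkDerivation_X, map_add, derivation_C, smul_eq_mul, eval_X, eval_C,
      mul_zero, zero_add]
    ring

end ChainRule

section Derivative

variable {𝕜 : Type*} [NontriviallyNormedField 𝕜] {f g : 𝕜 → Jet 𝕜} {f' g' : Jet 𝕜} {t : 𝕜}

/-- The family of jets `f` has derivative `f'` with respect to its parameter at `t`. -/
def HasDerivAt (f : 𝕜 → Jet 𝕜) (f' : Jet 𝕜) (t : 𝕜) : Prop :=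
  ∀ o, _root_.HasDerivAt (fun s => (f s).der o) (f'.der o) t

namespace HasDerivAt

theorem const (f : Jet 𝕜) (t : 𝕜) : HasDerivAt (fun _ => f) 0 t := fun _ => hasDerivAt_const t _

theorem unique (hf : HasDerivAt f f' t) (hg : HasDerivAt f g' t) : f' = g' :=
  Jet.ext <| funext fun o => (hf o).unique (hg o)

theorem add (hf : HasDerivAt f f' t) (hg : HasDerivAt g g' t) :
    HasDerivAt (fun s => f s + g s) (f' + g') t := fun o => (hf o).add (hg o)

theorem mul (hf : HasDerivAt f f' t) (hg : HasDerivAt g g' t) :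
    HasDerivAt (fun s => f s * g s) (f' * g t + f t * g') t := fun o => by
  fin_cases o
  · exact (hf 0).mul (hg 0)
  · exact (((hf 0).mul (hg 1)).add ((hf 1).mul (hg 0))).congr_deriv (by simp; ring)
  · exact ((((hf 0).mul (hg 2)).add (((hf 1).mul (hg 1)).const_mul 2)).add
      ((hf 2).mul (hg 0))).congr_deriv (by simp; ring)

theorem pow (hf : HasDerivAt f f' t) (n : ℕ) :
    HasDerivAt (fun s => f s ^ n) (n * f t ^ (n - 1) * f') t := by
  induction n with
  | zero => simpa using const 1 t
  | succ n ih =>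
    convert ih.mul hf using 1
    · simp only [pow_succ]
    · cases n with
      | zero => simp
      | succ n =>
        simp only [Nat.cast_add, Nat.cast_one, add_tsub_cancel_right, pow_succ]
        ring

theorem aeval {σ : Type*} [Fintype σ] {z : σ → 𝕜 → Jet 𝕜} {z' : σ → Jet 𝕜}
    (hz : ∀ k, HasDerivAt (z k) (z' k) t) (p : MvPolynomial σ 𝕜) :
    HasDerivAt (fun s => MvPolynomial.aeval (fun k => z k s) p)
      (∑ k, z' k * MvPolynomial.aeval (fun j => z j t) (pderiv k p)) t := by
  classical
  induction p using MvPolynomial.induction_on with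
  | C r => simpa using const (algebraMap 𝕜 (Jet 𝕜) r) t
  | add p q hp hq => simpa only [map_add, mul_add, Finset.sum_add_distrib] using hp.add hq
  | mul_X p k hp =>
    convert hp.mul (hz k) using 1
    · simp only [map_mul, aeval_X]
    · simp only [Derivation.leibniz, pderiv_X, Pi.single_apply, smul_eq_mul, map_add, map_mul,
        aeval_X, mul_add, Finset.sum_add_distrib, apply_ite, mul_one, mul_zero, map_zero,
        Finset.sum_ite_eq, Finset.mem_univ, if_true, Finset.sum_mul]
      rw [add_comm, mul_comm (z' k)]
      exact congrArg₂ _ (Finset.sum_congr rfl fun j _ => by ring) rfl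

end HasDerivAt

end Derivative

end Jet

section PolynomialMaps

/-- The polynomials in the chart coordinates of degree at most `e` in the coefficients `a_α`. -/
def paramDegreeLE (d e : ℕ) : Submodule ℂ (MvPolynomial (Coord d) ℂ) where
  carrier := {p | ∀ m ∈ p.support, ∑ α, m (.a α) ≤ e}
  add_mem' {p q} hp hq m hm := by
    classical exact (Finset.mem_union.1 (support_add hm)).elim (hp m) (hq m)
  zero_mem' := by simp
  smul_mem' c p hp m hm := hp m (support_smul hm)

theorem monomial_mem_paramDegreeLE {e : ℕ} {m : Coord d →₀ ℕ} (hm : ∑ α, m (.a α) ≤ e) (c : ℂ) :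
    monomial m c ∈ paramDegreeLE d e := fun n hn => by
  rw [Finset.mem_singleton.1 (support_monomial_subset hn)]
  exact hm

theorem paramDegreeLE_mono {e e' : ℕ} (h : e ≤ e') : paramDegreeLE d e ≤ paramDegreeLE d e' :=
  fun _ hp m hm => (hp m hm).trans h

theorem mul_mem_paramDegreeLE {e e' : ℕ} {p q : MvPolynomial (Coord d) ℂ}
    (hp : p ∈ paramDegreeLE d e) (hq : q ∈ paramDegreeLE d e') :
    p * q ∈ paramDegreeLE d (e + e') := fun m hm => by
  classical
  obtain ⟨a, ha, b, hb, rfl⟩ := Finset.mem_add.1 (support_mul _ _ hm)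
  simpa only [Finsupp.add_apply, Finset.sum_add_distrib] using add_le_add (hp a ha) (hq b hb)

/-- The polynomial maps from the chart coordinates to a complex vector space, of degree at most `e`
in the coefficients `a_α`. -/
def polyMaps (d e : ℕ) (A : Type*) [AddCommGroup A] [Module ℂ A] :
    Submodule ℂ ((Coord d → ℂ) → A) :=
  Submodule.span ℂ {F | ∃ p ∈ paramDegreeLE d e, ∃ a : A, F = fun x => eval x p • a}

namespace polyMaps

variable {e e' : ℕ} {A B : Type*}

section Module

variable [AddCommGroup A] [Module ℂ A] [AddCommGroup B] [Module ℂ B]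

theorem const (e : ℕ) (a : A) : (fun _ => a) ∈ polyMaps d e A :=
  Submodule.subset_span ⟨1, monomial_mem_paramDegreeLE (by simp) 1, a, by simp⟩

theorem coord {c : Coord d} (hc : ∀ α, c ≠ .a α) : (fun x => x c) ∈ polyMaps d 0 ℂ :=
  Submodule.subset_span ⟨X c, monomial_mem_paramDegreeLE (by simp [hc]) 1,
    1, by simp⟩

theorem coord_a (α : Idx d) : (fun x => x (.a α)) ∈ polyMaps d 1 ℂ :=
  Submodule.subset_span ⟨X (.a α),
    monomial_mem_paramDegreeLE (by simp [Finsupp.single_apply]) 1, 1, by simp⟩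

theorem add {F G : (Coord d → ℂ) → A} (hF : F ∈ polyMaps d e A) (hG : G ∈ polyMaps d e A) :
    (fun x => F x + G x) ∈ polyMaps d e A := Submodule.add_mem _ hF hG

theorem sum {ι : Type*} [Fintype ι] {F : ι → (Coord d → ℂ) → A} (hF : ∀ i, F i ∈ polyMaps d e A) :
    (fun x => ∑ i, F i x) ∈ polyMaps d e A := by
  simpa only [← Finset.sum_apply] using Submodule.sum_mem _ fun i _ => hF i

theorem mono (h : e ≤ e') : polyMaps d e A ≤ polyMaps d e' A :=
  Submodule.span_mono fun _ ⟨p, hp, a, hF⟩ => ⟨p, paramDegreeLE_mono h hp, a, hF⟩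

theorem map (L : A →ₗ[ℂ] B) {F : (Coord d → ℂ) → A} (hF : F ∈ polyMaps d e A) :
    (fun x => L (F x)) ∈ polyMaps d e B := by
  have h : polyMaps d e A ≤ (polyMaps d e B).comap (L.compLeft (Coord d → ℂ)) :=
    Submodule.span_le.2 fun _ ⟨p, hp, a, hF⟩ =>
      Submodule.subset_span ⟨p, hp, L a, by rw [hF]; ext; simp⟩
  exact h hF

theorem mem_iff {f : (Coord d → ℂ) → ℂ} :
    f ∈ polyMaps d e ℂ ↔ ∃ p ∈ paramDegreeLE d e, ∀ x, eval x p = f x := by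
  refine ⟨fun hf => ?_, fun ⟨p, hp, hf⟩ => Submodule.subset_span ⟨p, hp, 1, by ext; simp [hf]⟩⟩
  induction hf using Submodule.span_induction with
  | mem f hf =>
    obtain ⟨p, hp, a, rfl⟩ := hf
    exact ⟨a • p, Submodule.smul_mem _ a hp, fun x => by simp [mul_comm]⟩
  | zero => exact ⟨0, Submodule.zero_mem _, fun x => map_zero _⟩
  | add f g _ _ hf hg =>
    obtain ⟨p, hp, hf⟩ := hf
    obtain ⟨q, hq, hg⟩ := hg
    exact ⟨p + q, Submodule.add_mem _ hp hq, fun x => by simp [hf, hg]⟩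
  | smul c f _ hf =>
    obtain ⟨p, hp, hf⟩ := hf
    exact ⟨c • p, Submodule.smul_mem _ c hp, fun x => by simp [hf]⟩

theorem differentiable {f : (Coord d → ℂ) → ℂ} (hf : f ∈ polyMaps d e ℂ) :
    Differentiable ℂ f := by
  obtain ⟨p, -, hp⟩ := mem_iff.1 hf
  rw [← funext hp]
  exact differentiableOn_univ.1 (AnalyticOnNhd.eval_mvPolynomial p).differentiableOn

end Module

section Algebra

variable [CommRing A] [Algebra ℂ A]

theorem mul {F G : (Coord d → ℂ) → A} (hF : F ∈ polyMaps d e A) (hG : G ∈ polyMaps d e' A) :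
    (fun x => F x * G x) ∈ polyMaps d (e + e') A := by
  have h : polyMaps d e A * polyMaps d e' A ≤ polyMaps d (e + e') A := by
    rw [polyMaps, polyMaps, Submodule.span_mul_span, Submodule.span_le]
    rintro _ ⟨_, ⟨p, hp, a, rfl⟩, _, ⟨q, hq, b, rfl⟩, rfl⟩
    exact Submodule.subset_span
      ⟨p * q, mul_mem_paramDegreeLE hp hq, a * b, funext fun x => by
        simp only [map_mul, ← smul_mul_smul_comm, Pi.mul_apply]⟩
  exact h (Submodule.mul_mem_mul hF hG)

theorem zero_mul {F G : (Coord d → ℂ) → A} (hF : F ∈ polyMaps d 0 A) (hG : G ∈ polyMaps d e A) :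
    (fun x => F x * G x) ∈ polyMaps d e A := by
  simpa only [zero_add] using mul hF hG

theorem zero_smul {f : (Coord d → ℂ) → ℂ} {F : (Coord d → ℂ) → A} (hf : f ∈ polyMaps d 0 ℂ)
    (hF : F ∈ polyMaps d e A) : (fun x => f x • F x) ∈ polyMaps d e A := by
  simpa only [Algebra.linearMap_apply, ← Algebra.smul_def] using
    zero_mul (map (Algebra.linearMap ℂ A) hf) hF

theorem pow {F : (Coord d → ℂ) → A} (hF : F ∈ polyMaps d 0 A) (n : ℕ) :
    (fun x => F x ^ n) ∈ polyMaps d 0 A := by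
  induction n with
  | zero => simpa only [pow_zero] using const 0 1
  | succ n ih => simpa only [pow_succ] using zero_mul ih hF

end Algebra

theorem jet {F : (Coord d → ℂ) → Jet ℂ} (hF : ∀ o, (fun x => (F x).der o) ∈ polyMaps d e ℂ) :
    F ∈ polyMaps d e (Jet ℂ) := by
  have h : F = ∑ o, fun x =>
      (LinearMap.toSpanSingleton ℂ (Jet ℂ) ⟨Pi.single o 1⟩) ((F x).der o) := by
    ext x o
    simp [Finset.sum_apply, Jet.der_sum, Pi.single_apply]
  rw [h]
  exact Submodule.sum_mem _ fun o _ => map _ (hF o)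

theorem der {F : (Coord d → ℂ) → Jet ℂ} (hF : F ∈ polyMaps d e (Jet ℂ)) (o : Fin 3) :
    (fun x => (F x).der o) ∈ polyMaps d e ℂ := map (Jet.derₗ o) hF

theorem aeval {σ : Type*} {z : σ → (Coord d → ℂ) → Jet ℂ} (hz : ∀ k, z k ∈ polyMaps d 0 (Jet ℂ))
    (p : MvPolynomial σ ℂ) :
    (fun x => MvPolynomial.aeval (fun k => z k x) p) ∈ polyMaps d 0 (Jet ℂ) := by
  induction p using MvPolynomial.induction_on with
  | C r => simpa only [aeval_C] using const 0 _
  | add p q hp hq => simpa only [map_add] using add hp hq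
  | mul_X p k hp => simpa only [map_mul, aeval_X] using zero_mul hp (hz k)

end polyMaps

end PolynomialMaps

section Forms

/-- The exponent `α` as a finitely supported function. -/
def exponent (α : Idx d) : Fin 3 →₀ ℕ := Finsupp.equivFunOnFinite.symm α.1

/-- The coefficients of degree `d` of a ternary polynomial, indexed as in `form`. -/
def coeffVec (d : ℕ) : MvPolynomial (Fin 3) ℂ →ₗ[ℂ] (Idx d → ℂ) :=
  LinearMap.pi fun α => lcoeff ℂ (exponent α)

theorem exponent_injective : Function.Injective (exponent (d := d)) := fun _ _ h =>
  Subtype.ext (Finsupp.equivFunOnFinite.symm.injective h)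

theorem form_eq_sum_monomial (a : Idx d → ℂ) : form a = ∑ α, monomial (exponent α) (a α) := by
  refine Finset.sum_congr rfl fun α _ => ?_
  rw [monomial_eq, Finsupp.prod_fintype _ _ (by simp)]
  rfl

theorem form_add (a b : Idx d → ℂ) : form (a + b) = form a + form b := by
  simp [form_eq_sum_monomial, Finset.sum_add_distrib]

theorem form_smul (c : ℂ) (a : Idx d → ℂ) : form (c • a) = c • form a := by
  simp [form_eq_sum_monomial, Finset.smul_sum, smul_monomial]

theorem form_isHomogeneous (a : Idx d → ℂ) : (form a).IsHomogeneous d := by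
  rw [form_eq_sum_monomial]
  refine IsHomogeneous.sum _ _ _ fun α _ => isHomogeneous_monomial _ ?_
  rw [Finsupp.degree_eq_sum]
  exact Finset.Nat.mem_antidiagonalTuple.1 α.2

theorem coeffVec_form (a : Idx d → ℂ) : coeffVec d (form a) = a := by
  classical
  ext α
  simp [coeffVec, form_eq_sum_monomial, coeff_monomial, exponent_injective.eq_iff]

theorem form_coeffVec {p : MvPolynomial (Fin 3) ℂ} (hp : p.IsHomogeneous d) :
    form (coeffVec d p) = p := by
  ext m
  by_cases hm : m.degree = d
  · have hm' : ⇑m ∈ Finset.Nat.antidiagonalTuple 3 d := by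
      rw [Finset.Nat.mem_antidiagonalTuple, ← Finsupp.degree_eq_sum, hm]
    have hexp : m = exponent ⟨⇑m, hm'⟩ := by ext; simp [exponent]
    rw [hexp]
    exact congrFun (coeffVec_form (coeffVec d p)) ⟨⇑m, hm'⟩
  · rw [hp.coeff_eq_zero hm, (form_isHomogeneous _).coeff_eq_zero hm]

end Forms

section ChartJets

/-- The 2-jet of `Z_k / Z_i`, in terms of the coordinates of the chart `Z_i ≠ 0`. -/
def chartJet (i : Fin 3) (x : Coord d → ℂ) (k : Fin 3) : Jet ℂ := ⟨fun o => homJet i x o k⟩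

/-- The 2-jet of `Z₃ / Z_i`, in terms of the coordinates of the chart `Z_i ≠ 0`. -/
def lastJet (x : Coord d → ℂ) : Jet ℂ := Jet.exp fun o => x (.l o)

/-- The variation of `chartJet i` along a tangent vector `v`. -/
def dChartJet (i : Fin 3) (v : Coord d → ℂ) : Fin 3 → Jet ℂ :=
  Fin.insertNth (α := fun _ => Jet ℂ) i 0 fun k => ⟨fun o => v (.w o k)⟩

/-- The variation of `lastJet` at `x` along a tangent vector `v`. -/
def dLastJet (x v : Coord d → ℂ) : Jet ℂ :=
  ⟨![v (.l 0), v (.l 0) * x (.l 1) + x (.l 0) * v (.l 1),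
    v (.l 0) * (x (.l 2) + x (.l 1) ^ 2) + x (.l 0) * (v (.l 2) + 2 * x (.l 1) * v (.l 1))]⟩

@[simp] theorem chartJet_self (i : Fin 3) (x : Coord d → ℂ) : chartJet i x i = 1 := by
  apply Jet.ext_three <;> simp [chartJet, homJet]

@[simp] theorem chartJet_succAbove (i : Fin 3) (x : Coord d → ℂ) (k : Fin 2) :
    chartJet i x (i.succAbove k) = ⟨fun o => x (.w o k)⟩ := by
  ext o; simp [chartJet, homJet]

@[simp] theorem dChartJet_self (i : Fin 3) (v : Coord d → ℂ) : dChartJet i v i = 0 := by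
  simp [dChartJet]

@[simp] theorem dChartJet_succAbove (i : Fin 3) (v : Coord d → ℂ) (k : Fin 2) :
    dChartJet i v (i.succAbove k) = ⟨fun o => v (.w o k)⟩ := by
  simp [dChartJet]

theorem hasDerivAt_chartJet (i k : Fin 3) {y : ℂ → Coord d → ℂ} {y' : Coord d → ℂ} {t : ℂ}
    (hy : HasDerivAt y y' t) :
    Jet.HasDerivAt (fun s => chartJet i (y s) k) (dChartJet i y' k) t := by
  rcases Fin.eq_self_or_eq_succAbove i k with rfl | ⟨k, rfl⟩
  · simpa using Jet.HasDerivAt.const 1 t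
  · simp only [chartJet_succAbove, dChartJet_succAbove]
    exact fun o => hasDerivAt_pi.1 hy (.w o k)

theorem hasDerivAt_add_smul (x v : Coord d → ℂ) :
    HasDerivAt (fun s : ℂ => x + s • v) v 0 := by
  simpa using ((hasDerivAt_id (0 : ℂ)).smul_const v).const_add x

theorem hasDerivAt_lastJet (x v : Coord d → ℂ) :
    Jet.HasDerivAt (fun s : ℂ => lastJet (x + s • v)) (dLastJet x v) 0 := by
  have hl (o : Fin 3) : HasDerivAt (fun s : ℂ => (x + s • v) (.l o)) (v (.l o)) 0 :=
    hasDerivAt_pi.1 (hasDerivAt_add_smul x v) (.l o)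
  intro o
  fin_cases o
  · exact hl 0
  · exact ((hl 0).mul (hl 1)).congr_deriv (by simp [dLastJet])
  · exact ((hl 0).mul ((hl 2).add ((hl 1).pow 2))).congr_deriv (by simp [dLastJet])

theorem hasDerivAt_aeval_form {z : Fin 3 → ℂ → Jet ℂ} {z' : Fin 3 → Jet ℂ}
    (hz : ∀ k, Jet.HasDerivAt (z k) (z' k) 0) (a b : Idx d → ℂ) :
    Jet.HasDerivAt (fun s => aeval (fun k => z k s) (form (a + s • b)))
      (∑ k, z' k * aeval (fun j => z j 0) (pderiv k (form a)) + aeval (fun j => z j 0) (form b))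
      0 := by
  have hs : Jet.HasDerivAt (fun s : ℂ => algebraMap ℂ (Jet ℂ) s) 1 0 := fun o => by
    fin_cases o
    exacts [hasDerivAt_id _, hasDerivAt_const _ _, hasDerivAt_const _ _]
  have h := (Jet.HasDerivAt.aeval hz (form a)).add (hs.mul (Jet.HasDerivAt.aeval hz (form b)))
  simp only [map_zero, zero_mul, add_zero, one_mul] at h
  simp only [form_add, form_smul, map_add, map_smul]
  simpa only [Algebra.smul_def] using h

/-- The 2-jet of `w₃^d + P_a`, whose components are the equations of the jet space. -/
def eqnsJet (i : Fin 3) (x : Coord d → ℂ) : Jet ℂ :=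
  lastJet x ^ d + aeval (chartJet i x) (form (coeffs x))

theorem eqns_eq_der (i : Fin 3) (x : Coord d → ℂ) : eqns d i x = (eqnsJet i x).der := by
  funext o
  rw [eqnsJet, lastJet, Jet.exp_pow, Jet.der_add, Pi.add_apply]
  fin_cases o
  · simp [eqns, Jet.exp, Jet.der_zero_aeval, chartJet]
  · simp only [eqns, Jet.exp, Jet.der_one_aeval, chartJet, mkDerivation_eq_sum, map_sum, map_mul,
      eval_C, mul_comm, Matrix.cons_val, Fin.isValue, Fin.mk_one]
    ring
  · simp only [eqns, Jet.exp, Jet.der_two_aeval, chartJet, mkDerivation_eq_sum, map_sum, map_add,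
      map_mul, Derivation.leibniz, derivation_C, smul_eq_mul, Finset.mul_sum, mul_zero, add_zero,
      eval_C, Matrix.cons_val, Fin.isValue, Fin.reduceFinMk]
    rw [Finset.sum_comm]
    simp only [mul_comm, mul_left_comm, mul_assoc, add_assoc, mul_add]
    ring

theorem eqns_eq_zero_iff (i : Fin 3) (x : Coord d → ℂ) : eqns d i x = 0 ↔ eqnsJet i x = 0 := by
  rw [eqns_eq_der, Jet.ext_iff, Jet.der_zero]

/-- The variation of `eqnsJet i` at `x` along a tangent vector `v`. -/
def dEqnsJet (i : Fin 3) (x v : Coord d → ℂ) : Jet ℂ :=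
  d * lastJet x ^ (d - 1) * dLastJet x v +
    (∑ k, dChartJet i v k * aeval (chartJet i x) (pderiv k (form (coeffs x))) +
      aeval (chartJet i x) (form (coeffs v)))

theorem hasDerivAt_eqnsJet (i : Fin 3) (x v : Coord d → ℂ) :
    Jet.HasDerivAt (fun s : ℂ => eqnsJet i (x + s • v)) (dEqnsJet i x v) 0 := by
  have h := ((hasDerivAt_lastJet x v).pow d).add
    (hasDerivAt_aeval_form (fun k => hasDerivAt_chartJet i k (hasDerivAt_add_smul x v))
      (coeffs x) (coeffs v))
  simp only [zero_smul, add_zero] at h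
  exact h

theorem chartJet_mem_polyMaps (i k : Fin 3) :
    (fun x => chartJet i x k) ∈ polyMaps d 0 (Jet ℂ) := by
  rcases Fin.eq_self_or_eq_succAbove i k with rfl | ⟨k, rfl⟩
  · simpa using polyMaps.const 0 1
  · exact polyMaps.jet fun o => by simpa using polyMaps.coord (by simp)

theorem lastJet_mem_polyMaps : lastJet ∈ polyMaps d 0 (Jet ℂ) := by
  have hl (o : Fin 3) : (fun x => x (.l o)) ∈ polyMaps d 0 ℂ := polyMaps.coord (by simp)
  refine polyMaps.jet fun o => ?_
  fin_cases o
  · exact hl 0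
  · exact polyMaps.zero_mul (hl 0) (hl 1)
  · exact polyMaps.zero_mul (hl 0) (polyMaps.add (hl 2) (polyMaps.pow (hl 1) 2))

theorem eqnsJet_mem_polyMaps (i : Fin 3) : eqnsJet i ∈ polyMaps d 1 (Jet ℂ) := by
  have hcoeff (α : Idx d) :
      (fun x => algebraMap ℂ (Jet ℂ) (x (.a α))) ∈ polyMaps d 1 (Jet ℂ) :=
    polyMaps.map (Algebra.linearMap ℂ (Jet ℂ)) (polyMaps.coord_a α)
  have hmonomial (α : Idx d) :
      (fun x => aeval (chartJet i x) (monomial (exponent α) (1 : ℂ))) ∈ polyMaps d 0 (Jet ℂ) :=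
    polyMaps.aeval (chartJet_mem_polyMaps i) _
  have hform : (fun x => aeval (chartJet i x) (form (coeffs x))) ∈ polyMaps d 1 (Jet ℂ) := by
    have h := polyMaps.sum fun α => polyMaps.zero_mul (hmonomial α) (hcoeff α)
    simpa only [form_eq_sum_monomial, map_sum, aeval_monomial, map_one, one_mul, coeffs,
      mul_comm] using h
  exact polyMaps.add (polyMaps.mono zero_le_one (polyMaps.pow lastJet_mem_polyMaps d)) hform

theorem fderiv_eqns (i : Fin 3) (x v : Coord d → ℂ) :
    fderiv ℂ (eqns d i) x v = (dEqnsJet i x v).der := by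
  have hdiff : DifferentiableAt ℂ (eqns d i) x := by
    rw [funext (eqns_eq_der i)]
    exact differentiableAt_pi.2 fun o =>
      polyMaps.differentiable (polyMaps.der (eqnsJet_mem_polyMaps i) o) x
  rw [← hdiff.lineDeriv_eq_fderiv]
  refine HasDerivAt.deriv (hasDerivAt_pi.2 fun o => ?_)
  simpa only [eqns_eq_der] using hasDerivAt_eqnsJet i x v o

theorem mem_tangentSpace_iff (i : Fin 3) (x v : Coord d → ℂ) :
    v ∈ tangentSpace i x ↔ dEqnsJet i x v = 0 := by
  rw [tangentSpace, LinearMap.mem_ker, ContinuousLinearMap.coe_coe, fderiv_eqns, Jet.ext_iff,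
    Jet.der_zero]

end ChartJets

section Transition

theorem Jet.quotJet_mul (f : Jet ℂ) {g : Jet ℂ} (hg : g.der 0 ≠ 0) :
    ⟨quotJet f.der g.der⟩ * g = f := by
  apply Jet.ext_three <;> simp only [quotJet, Jet.der_mul, Matrix.cons_val] <;> field_simp <;> ring

theorem Jet.isUnit_of_der_zero_ne_zero {g : Jet ℂ} (hg : g.der 0 ≠ 0) : IsUnit g :=
  .of_mul_eq_one_right _ (Jet.quotJet_mul 1 hg)

theorem Jet.exp_quotLogJet_mul (l : Fin 3 → ℂ) {g : Jet ℂ} (hg : g.der 0 ≠ 0) :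
    Jet.exp (quotLogJet l g.der) * g = Jet.exp l := by
  apply Jet.ext_three <;>
    simp only [Jet.exp, quotLogJet, Jet.der_mul, Matrix.cons_val] <;> field_simp <;> ring

variable {i j : Fin 3} {x : Coord d → ℂ}

theorem isUnit_chartJet (h : homJet i x 0 j ≠ 0) : IsUnit (chartJet i x j) :=
  Jet.isUnit_of_der_zero_ne_zero h

theorem chartJet_transition (h : homJet i x 0 j ≠ 0) (k : Fin 3) :
    chartJet j (transition d i j x) k * chartJet i x j = chartJet i x k := by
  rcases Fin.eq_self_or_eq_succAbove j k with rfl | ⟨k, rfl⟩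
  · rw [chartJet_self, one_mul]
  · have hquot : (fun o => transition d i j x (.w o k)) =
        quotJet (chartJet i x (j.succAbove k)).der (chartJet i x j).der := rfl
    rw [chartJet_succAbove, hquot, Jet.quotJet_mul _ h]

theorem lastJet_transition (h : homJet i x 0 j ≠ 0) :
    lastJet (transition d i j x) * chartJet i x j = lastJet x := by
  have hlog : (fun o => transition d i j x (.l o)) =
      quotLogJet (fun o => x (.l o)) (chartJet i x j).der := rfl
  rw [lastJet, lastJet, hlog, Jet.exp_quotLogJet_mul _ h]

theorem eqnsJet_transition (h : homJet i x 0 j ≠ 0) :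
    eqnsJet j (transition d i j x) * chartJet i x j ^ d = eqnsJet i x := by
  have hform : aeval (chartJet i x) (form (coeffs x)) =
      chartJet i x j ^ d * aeval (chartJet j (transition d i j x)) (form (coeffs x)) := by
    rw [← aeval_mul_of_isHomogeneous (form_isHomogeneous _)]
    simp only [mul_comm (chartJet i x j), chartJet_transition h]
  rw [eqnsJet, eqnsJet, hform, add_mul, ← mul_pow, lastJet_transition h, mul_comm (_ ^ d)]
  rfl

theorem transition_mem_jetChart (h : homJet i x 0 j ≠ 0) (hx : x ∈ jetChart d i) :
    transition d i j x ∈ jetChart d j := by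
  refine ⟨hx.1, (eqns_eq_zero_iff _ _).2 ?_⟩
  rw [← ((isUnit_chartJet h).pow d).mul_left_eq_zero, eqnsJet_transition h]
  exact (eqns_eq_zero_iff _ _).1 hx.2

@[fun_prop]
theorem differentiable_homJet (i o k : Fin 3) :
    Differentiable ℂ fun x : Coord d → ℂ => homJet i x o k :=
  polyMaps.differentiable (polyMaps.der (chartJet_mem_polyMaps i k) o)

theorem differentiableAt_transition (h : homJet i x 0 j ≠ 0) :
    DifferentiableAt ℂ (transition d i j) x := by
  have h2 := pow_ne_zero 2 h
  have h3 := pow_ne_zero 3 h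
  refine differentiableAt_pi.2 fun c => ?_
  rcases c with ⟨o, k⟩ | o | α
  · fin_cases o <;> simp only [transition, quotJet, Fin.zero_eta, Fin.mk_one, Fin.reduceFinMk,
      Matrix.cons_val] <;> fun_prop (disch := assumption)
  · fin_cases o <;> simp only [transition, quotLogJet, Fin.zero_eta, Fin.mk_one, Fin.reduceFinMk,
      Matrix.cons_val] <;> fun_prop (disch := assumption)
  · simp only [transition]
    fun_prop

theorem hasDerivAt_transition_add_smul (h : homJet i x 0 j ≠ 0) (v : Coord d → ℂ) :
    HasDerivAt (fun s : ℂ => transition d i j (x + s • v)) (fderiv ℂ (transition d i j) x v) 0 :=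
  (differentiableAt_transition h).hasFDerivAt.hasLineDerivAt v

theorem eventually_homJet_add_smul_ne_zero (h : homJet i x 0 j ≠ 0) (v : Coord d → ℂ) :
    ∀ᶠ s : ℂ in nhds 0, homJet i (x + s • v) 0 j ≠ 0 := by
  have hcont : Continuous fun s : ℂ => homJet i (x + s • v) 0 j :=
    (differentiable_homJet i 0 j).continuous.comp (by fun_prop)
  exact hcont.continuousAt.eventually_ne (by simpa using h)

theorem dChartJet_fderiv_transition (h : homJet i x 0 j ≠ 0) (v : Coord d → ℂ) (k : Fin 3) :
    dChartJet j (fderiv ℂ (transition d i j) x v) k * chartJet i x j +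
      chartJet j (transition d i j x) k * dChartJet i v j = dChartJet i v k := by
  have hmul := (hasDerivAt_chartJet j k (hasDerivAt_transition_add_smul h v)).mul
    (hasDerivAt_chartJet i j (hasDerivAt_add_smul x v))
  simp only [zero_smul, add_zero] at hmul
  refine Jet.HasDerivAt.unique (fun o => (hmul o).congr_of_eventuallyEq ?_)
    (hasDerivAt_chartJet i k (hasDerivAt_add_smul x v))
  filter_upwards [eventually_homJet_add_smul_ne_zero h v] with s hs
  rw [chartJet_transition hs]

theorem hasDerivAt_quotLogJet {l : ℂ → Fin 3 → ℂ} {l' : Fin 3 → ℂ} {g : ℂ → Jet ℂ} {η : Jet ℂ}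
    {t : ℂ} (hl : HasDerivAt l l' t) (hg : Jet.HasDerivAt g (η * g t) t) (h : (g t).der 0 ≠ 0) :
    HasDerivAt (fun s => quotLogJet (l s) (g s).der)
      ![(l' 0 - l t 0 * η.der 0) / (g t).der 0, l' 1 - η.der 1, l' 2 - η.der 2] t := by
  have hl := hasDerivAt_pi.1 hl
  have hg1 := (hg 1).fun_div (hg 0) h
  refine hasDerivAt_pi.2 fun o => ?_
  fin_cases o
  · refine ((hl 0).fun_div (hg 0) h).congr_deriv ?_
    simp only [Fin.zero_eta, Fin.isValue, Jet.der_mul, Matrix.cons_val]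
    field_simp
  · refine ((hl 1).fun_sub hg1).congr_deriv ?_
    simp only [Fin.mk_one, Fin.isValue, Jet.der_mul, Matrix.cons_val, sub_right_inj]
    field_simp
    ring
  · refine ((hl 2).fun_sub (((hg 2).fun_div (hg 0) h).fun_sub (hg1.fun_pow 2))).congr_deriv ?_
    simp only [Fin.reduceFinMk, Fin.isValue, Jet.der_mul, Matrix.cons_val, sub_right_inj,
      Nat.cast_ofNat, Nat.add_one_sub_one, pow_one]
    field_simp
    ring

theorem fderiv_transition_eq {v w : Coord d → ℂ} {η : Jet ℂ} (h : homJet i x 0 j ≠ 0)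
    (hη : dChartJet i v j = η * chartJet i x j)
    (hw : ∀ k, dChartJet i v k =
      (dChartJet j w k + chartJet j (transition d i j x) k * η) * chartJet i x j)
    (hl : v (.l 0) = (w (.l 0) + transition d i j x (.l 0) * η.der 0) * homJet i x 0 j)
    (hl' : ∀ o, o ≠ 0 → w (.l o) = v (.l o) - η.der o) (ha : ∀ α, w (.a α) = v (.a α)) :
    fderiv ℂ (transition d i j) x v = w := by
  have hT := hasDerivAt_pi.1 (hasDerivAt_transition_add_smul h v)
  funext c
  rcases c with ⟨o, k⟩ | o | α
  · have hk : dChartJet j (fderiv ℂ (transition d i j) x v) (j.succAbove k) =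
        dChartJet j w (j.succAbove k) := by
      refine (isUnit_chartJet h).mul_right_cancel ?_
      rw [eq_sub_of_add_eq (dChartJet_fderiv_transition h v _), hw, hη]
      ring
    simpa using congrArg (fun f : Jet ℂ => f.der o) hk
  · have hx (o : Fin 3) := hasDerivAt_pi.1 (hasDerivAt_add_smul x v) (.l o)
    have hg := hasDerivAt_chartJet i j (hasDerivAt_add_smul x v)
    rw [hη] at hg
    have hlog := hasDerivAt_quotLogJet (η := η) (g := fun s : ℂ => chartJet i (x + s • v) j)
      (hasDerivAt_pi.2 hx) (by simpa using hg) (by simpa [chartJet] using h)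
    refine (hT (.l o)).unique ((hasDerivAt_pi.1 hlog o).congr_deriv ?_)
    fin_cases o
    · have hx0 : x (.l 0) = transition d i j x (.l 0) * homJet i x 0 j :=
        (div_mul_cancel₀ _ h).symm
      simp only [chartJet, hl, hx0, zero_smul, Pi.add_apply, Pi.zero_apply, add_zero,
        Fin.zero_eta, Fin.isValue, Matrix.cons_val]
      field_simp
      ring
    · simp [hl' 1]
    · simp [hl' 2]
  · rw [ha]
    exact (hT (.a α)).unique (hasDerivAt_pi.1 (hasDerivAt_add_smul x v) (.a α))

end Transition

section Sections

/-- The vector fields `V i` on the charts are polynomial of degree at most `e` in the coefficients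
`a_α`, tangent to the log jet space, and glue to a section of the twist by `𝒪(c)`. This is
`GlobalSection`, with polynomial functions instead of polynomials. -/
structure IsSection (d c e : ℕ) (V : Fin 3 → (Coord d → ℂ) → Coord d → ℂ) : Prop where
  poly : ∀ i k, (fun x => V i x k) ∈ polyMaps d e ℂ
  tangent : ∀ i, ∀ x ∈ jetChart d i, V i x ∈ tangentSpace i x
  compat : ∀ i j, ∀ x ∈ jetChart d i, homJet i x 0 j ≠ 0 →
    fderiv ℂ (transition d i j) x (V i x) = homJet i x 0 j ^ c • V j (transition d i j x)

namespace IsSection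

variable {c e : ℕ} {V W : Fin 3 → (Coord d → ℂ) → Coord d → ℂ}

theorem exists_globalSection (h : IsSection d c e V) :
    ∃ s : GlobalSection d c e, ∀ i x, s.value i x = V i x := by
  choose p hdeg hp using fun i k => polyMaps.mem_iff.1 (h.poly i k)
  have hp' (i : Fin 3) (x : Coord d → ℂ) : (fun k => eval x (p i k)) = V i x :=
    funext fun k => hp i k x
  exact ⟨⟨p, fun i x hx => by rw [hp']; exact h.tangent i x hx,
    fun i j x hx hj => by rw [hp', hp']; exact h.compat i j x hx hj, hdeg⟩, hp'⟩

theorem zero : IsSection d c e fun _ _ => 0 where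
  poly _ _ := Submodule.zero_mem _
  tangent _ _ _ := zero_mem _
  compat _ _ _ _ _ := by rw [map_zero, smul_zero]

theorem add (hV : IsSection d c e V) (hW : IsSection d c e W) :
    IsSection d c e fun i x => V i x + W i x where
  poly i k := polyMaps.add (hV.poly i k) (hW.poly i k)
  tangent i x hx := add_mem (hV.tangent i x hx) (hW.tangent i x hx)
  compat i j x hx hj := by
    rw [map_add, hV.compat i j x hx hj, hW.compat i j x hx hj, smul_add]

theorem smul (t : ℂ) (hV : IsSection d c e V) : IsSection d c e fun i x => t • V i x where
  poly i k := Submodule.smul_mem _ t (hV.poly i k)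
  tangent i x hx := Submodule.smul_mem _ _ (hV.tangent i x hx)
  compat i j x hx hj := by rw [map_smul, hV.compat i j x hx hj, smul_comm]

theorem mono {e' : ℕ} (he : e ≤ e') (hV : IsSection d c e V) : IsSection d c e' V where
  poly i k := polyMaps.mono he (hV.poly i k)
  tangent := hV.tangent
  compat := hV.compat

theorem mul_pow (hV : IsSection d c e V) (l : Fin 3) (n : ℕ) :
    IsSection d (c + n) e fun i x => homJet i x 0 l ^ n • V i x where
  poly i k := polyMaps.zero_mul
    (polyMaps.pow (polyMaps.der (chartJet_mem_polyMaps i l) 0) n) (hV.poly i k)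
  tangent i x hx := Submodule.smul_mem _ _ (hV.tangent i x hx)
  compat i j x hx hj := by
    rw [map_smul, hV.compat i j x hx hj, homJet_transition i j x hj, smul_smul, smul_smul]
    congr 1
    rw [div_pow, pow_add]
    field_simp

end IsSection

/-- The values at a point of the chart `Z_i ≠ 0` of the sections of the twist by `𝒪(c)` and
`𝒪(e)`. -/
def sectionValues (c e : ℕ) (i : Fin 3) (x : Coord d → ℂ) : Submodule ℂ (Coord d → ℂ) where
  carrier := {v | ∃ V, IsSection d c e V ∧ V i x = v}
  zero_mem' := ⟨_, .zero, rfl⟩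
  add_mem' := by
    rintro _ _ ⟨V, hV, rfl⟩ ⟨W, hW, rfl⟩
    exact ⟨_, hV.add hW, rfl⟩
  smul_mem' := by
    rintro t _ ⟨V, hV, rfl⟩
    exact ⟨_, hV.smul t, rfl⟩

end Sections

section LinearForms

variable {R : Type*} [CommRing R]

/-- The linear form with coefficients `c`. -/
def linForm (c : Fin 3 → R) : MvPolynomial (Fin 3) R :=
  ∑ k, C (c k) * X k

/-- The derivation of `R[X₀, X₁, X₂]` with `X_k ↦ ∑ l, M k l X_l`. -/
def linDerivation (M : Matrix (Fin 3) (Fin 3) R) :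
    Derivation R (MvPolynomial (Fin 3) R) (MvPolynomial (Fin 3) R) :=
  mkDerivation R fun k => linForm (M k)

theorem isHomogeneous_linForm (c : Fin 3 → R) :
    (linForm c).IsHomogeneous 1 :=
  .sum _ _ _ fun k _ => isHomogeneous_C_mul_X (c k) k

theorem isHomogeneous_linDerivation (M : Matrix (Fin 3) (Fin 3) R) {p : MvPolynomial (Fin 3) R}
    {n : ℕ} (hp : p.IsHomogeneous n) : (linDerivation M p).IsHomogeneous n := by
  cases n with
  | zero =>
    rw [totalDegree_eq_zero_iff_eq_C.1 ((totalDegree_zero_iff_isHomogeneous _).2 hp),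
      derivation_C]
    exact isHomogeneous_zero _ _ _
  | succ n =>
    rw [linDerivation, mkDerivation_eq_sum, add_comm]
    exact .sum _ _ _ fun k _ => (isHomogeneous_linForm (M k)).mul hp.pderiv

end LinearForms

section LinearFields

/-- The vector field induced by the infinitesimal linear substitution `M` of `(Z₀, Z₁, Z₂)`, which
leaves `Z₃` and the equation of `𝒴` invariant. -/
def glField (M : Matrix (Fin 3) (Fin 3) ℂ) (i : Fin 3) (x : Coord d → ℂ) : Coord d → ℂ :=
  let z := chartJet i x
  let γ := aeval z (linForm (M i))
  fun
  | .w o k => (aeval z (linForm (M (i.succAbove k))) - γ * z (i.succAbove k)).der o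
  | .l o => ![-(γ.der 0 * x (.l 0)), -γ.der 1, -γ.der 2] o
  | .a α => -coeffVec d (linDerivation M (form (coeffs x))) α

theorem dChartJet_glField (M : Matrix (Fin 3) (Fin 3) ℂ) (i : Fin 3) (x : Coord d → ℂ)
    (k : Fin 3) : dChartJet i (glField M i x) k =
      aeval (chartJet i x) (linForm (M k)) -
        aeval (chartJet i x) (linForm (M i)) * chartJet i x k := by
  rcases Fin.eq_self_or_eq_succAbove i k with rfl | ⟨k, rfl⟩
  · rw [dChartJet_self, chartJet_self, mul_one, sub_self]
  · rw [dChartJet_succAbove]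
    rfl

theorem dLastJet_glField (M : Matrix (Fin 3) (Fin 3) ℂ) (i : Fin 3) (x : Coord d → ℂ) :
    dLastJet x (glField M i x) = -aeval (chartJet i x) (linForm (M i)) * lastJet x := by
  apply Jet.ext_three <;> simp [dLastJet, lastJet, glField, Jet.exp] <;> ring

theorem coeffs_glField (M : Matrix (Fin 3) (Fin 3) ℂ) (i : Fin 3) (x : Coord d → ℂ) :
    coeffs (glField M i x) = coeffVec d (-linDerivation M (form (coeffs x))) := by
  rw [map_neg]
  rfl

theorem dEqnsJet_glField (M : Matrix (Fin 3) (Fin 3) ℂ) (i : Fin 3) (x : Coord d → ℂ) :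
    dEqnsJet i x (glField M i x) =
      -(d * aeval (chartJet i x) (linForm (M i))) * eqnsJet i x := by
  set z := chartJet i x with hz
  set p := form (coeffs x) with hp
  have hhom : p.IsHomogeneous d := form_isHomogeneous _
  have hlast : (d : Jet ℂ) * lastJet x ^ (d - 1) * lastJet x = d * lastJet x ^ d := by
    cases d
    · simp
    · rw [Nat.add_sub_cancel, mul_assoc, pow_succ]
  have heuler : ∑ k, z k * aeval z (pderiv k p) = d * aeval z p := by
    simpa using congrArg (aeval z) hhom.sum_X_mul_pderiv
  have hlin : aeval z (linDerivation M p) =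
      ∑ k, aeval z (linForm (M k)) * aeval z (pderiv k p) := by
    simp only [linDerivation, mkDerivation_eq_sum, map_sum, map_mul]
  rw [dEqnsJet, coeffs_glField, form_coeffVec (isHomogeneous_linDerivation M hhom).neg,
    dLastJet_glField]
  simp only [dChartJet_glField, ← hz, ← hp, sub_mul, mul_assoc, Finset.sum_sub_distrib,
    ← Finset.mul_sum, heuler, map_neg, hlin, eqnsJet]
  linear_combination -aeval z (linForm (M i)) * hlast

theorem form_coeffs_mem_polyMaps :
    (fun x : Coord d → ℂ => form (coeffs x)) ∈ polyMaps d 1 (MvPolynomial (Fin 3) ℂ) := by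
  simpa only [form_eq_sum_monomial, coeffs] using
    polyMaps.sum fun α => polyMaps.map (monomial (exponent α)) (polyMaps.coord_a α)

theorem aeval_chartJet_transition_mul {i j : Fin 3} {x : Coord d → ℂ} (h : homJet i x 0 j ≠ 0)
    (c : Fin 3 → ℂ) :
    aeval (chartJet j (transition d i j x)) (linForm c) * chartJet i x j =
      aeval (chartJet i x) (linForm c) := by
  simp only [linForm, map_sum, map_mul, aeval_X, aeval_C, Finset.sum_mul, mul_assoc,
    chartJet_transition h]

theorem isSection_glField (M : Matrix (Fin 3) (Fin 3) ℂ) :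
    IsSection d 0 1 (glField M) where
  poly i c := by
    have hz (k : Fin 3) := chartJet_mem_polyMaps (d := d) i k
    have hM (k : Fin 3) := polyMaps.aeval hz (linForm (M k))
    rcases c with ⟨o, k⟩ | o | α
    · refine polyMaps.mono zero_le_one (polyMaps.der ?_ o)
      exact Submodule.sub_mem _ (hM _) (polyMaps.zero_mul (hM i) (hz _))
    · refine polyMaps.mono zero_le_one ?_
      fin_cases o
      · exact Submodule.neg_mem _
          (polyMaps.zero_mul (polyMaps.der (hM i) 0) (polyMaps.coord (by simp)))
      · exact Submodule.neg_mem _ (polyMaps.der (hM i) 1)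
      · exact Submodule.neg_mem _ (polyMaps.der (hM i) 2)
    · exact Submodule.neg_mem _ (polyMaps.map (LinearMap.proj α ∘ₗ coeffVec d ∘ₗ
        (linDerivation M).toLinearMap) form_coeffs_mem_polyMaps)
  tangent i x hx := by
    rw [mem_tangentSpace_iff, dEqnsJet_glField, (eqns_eq_zero_iff i x).1 hx.2, mul_zero]
  compat i j x _ h := by
    have hM := aeval_chartJet_transition_mul h
    have hx0 : transition d i j x (.l 0) * homJet i x 0 j = x (.l 0) := div_mul_cancel₀ _ h
    rw [pow_zero, one_smul]
    refine fderiv_transition_eq (η := aeval (chartJet j (transition d i j x)) (linForm (M j)) -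
      aeval (chartJet i x) (linForm (M i))) h ?_ (fun k => ?_) ?_ (fun o ho => ?_) fun α => rfl
    · rw [dChartJet_glField, ← hM (M j)]
      ring
    · rw [dChartJet_glField, dChartJet_glField, ← hM (M k), ← chartJet_transition h k]
      ring
    · simp only [glField, Matrix.cons_val, Jet.der_sub, Pi.sub_apply, ← hx0]
      ring
    · fin_cases o
      · exact absurd rfl ho
      · simp [glField, neg_sub_left]
      · simp [glField, neg_sub_left]

end LinearFields

section ParameterFields

/-- The tangent vector with components `b` along the coefficients `a_α` and zero along the jet
coordinates. -/
def paramVec (d : ℕ) : (Idx d → ℂ) →ₗ[ℂ] (Coord d → ℂ) :=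
  LinearMap.pi fun
    | .a α => LinearMap.proj α
    | _ => 0

theorem coeffs_paramVec (b : Idx d → ℂ) : coeffs (paramVec d b) = b := rfl

theorem dChartJet_paramVec (i : Fin 3) (b : Idx d → ℂ) (k : Fin 3) :
    dChartJet i (paramVec d b) k = 0 := by
  rcases Fin.eq_self_or_eq_succAbove i k with rfl | ⟨k, rfl⟩
  · rw [dChartJet_self]
  · rw [dChartJet_succAbove]
    rfl

theorem paramVec_mem_tangentSpace_iff {i : Fin 3} {x : Coord d → ℂ} {b : Idx d → ℂ} :
    paramVec d b ∈ tangentSpace i x ↔ aeval (chartJet i x) (form b) = 0 := by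
  have hlast : dLastJet x (paramVec d b) = 0 := by
    apply Jet.ext_three <;> simp [dLastJet, paramVec]
  simp only [mem_tangentSpace_iff, dEqnsJet, hlast, dChartJet_paramVec, coeffs_paramVec, mul_zero,
    zero_mul, Finset.sum_const_zero, zero_add]

theorem fderiv_transition_paramVec {i j : Fin 3} {x : Coord d → ℂ} (h : homJet i x 0 j ≠ 0)
    (b : Idx d → ℂ) : fderiv ℂ (transition d i j) x (paramVec d b) = paramVec d b := by
  refine fderiv_transition_eq (η := 0) h ?_ (fun k => ?_) ?_ (fun o _ => ?_) fun α => rfl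
  · rw [dChartJet_paramVec, zero_mul]
  · rw [dChartJet_paramVec, dChartJet_paramVec, mul_zero, add_zero, zero_mul]
  · simp [paramVec]
  · simp [paramVec]

/-- `Q z` is a form of degree `d` vanishing along the jet `z` of `(Z₀, Z₁, Z₂)`. It depends
polynomially on `z` and has weight `c` under rescaling of the homogeneous coordinates, so moving
the coefficients `a_α` in the direction `Q z` is a section of the twist by `𝒪(c)`. -/
structure IsVanishingForm (d c : ℕ) (Q : (Fin 3 → Jet ℂ) → MvPolynomial (Fin 3) ℂ) : Prop where
  poly : ∀ i, (fun x => Q (chartJet i x)) ∈ polyMaps d 0 (MvPolynomial (Fin 3) ℂ)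
  isHomogeneous : ∀ z, (Q z).IsHomogeneous d
  aeval_eq_zero : ∀ z, aeval z (Q z) = 0
  mul_left : ∀ g z, Q (fun k => g * z k) = g.der 0 ^ c • Q z

theorem IsVanishingForm.isSection {c : ℕ} {Q : (Fin 3 → Jet ℂ) → MvPolynomial (Fin 3) ℂ}
    (hQ : IsVanishingForm d c Q) :
    IsSection d c 0 fun i x => paramVec d (coeffVec d (Q (chartJet i x))) where
  poly i k := polyMaps.map (LinearMap.proj k ∘ₗ paramVec d ∘ₗ coeffVec d) (hQ.poly i)
  tangent i x _ := by
    rw [paramVec_mem_tangentSpace_iff, form_coeffVec (hQ.isHomogeneous _), hQ.aeval_eq_zero]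
  compat i j x _ h := by
    have hz : chartJet i x = fun k => chartJet i x j * chartJet j (transition d i j x) k :=
      funext fun k => by rw [mul_comm, chartJet_transition h]
    rw [fderiv_transition_paramVec h]
    conv_lhs => rw [hz]
    rw [hQ.mul_left, map_smul, map_smul]
    rfl

end ParameterFields

section VanishingForms

open scoped Matrix

section Definitions

variable {R : Type*} [CommRing R]

/-- The linear form `Z_i(0) X_b - Z_b(0) X_i`, which vanishes at the base point of the jet `z`. -/
def vanForm (i b : Fin 3) (z : Fin 3 → Jet R) : MvPolynomial (Fin 3) R :=
  (z i).der 0 • X b - (z b).der 0 • X i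

/-- The first derivative of `vanForm i b z` along the jet `z`. -/
def vanDeriv (i b : Fin 3) (z : Fin 3 → Jet R) : R :=
  (z i).der 0 * (z b).der 1 - (z b).der 0 * (z i).der 1

/-- The homogeneous Wronskian of a jet. -/
def jetDet (z : Fin 3 → Jet R) : R := Matrix.det (Matrix.of fun o k => (z k).der o)

/-- The equation of the tangent line to the jet `z` at its base point. -/
def tangentForm (z : Fin 3 → Jet R) : MvPolynomial (Fin 3) R :=
  linForm ((fun k => (z k).der 0) ⨯₃ fun k => (z k).der 1)

/-- A form vanishing to order three at the base point of the jet `z`. The factor `Z_i(0)^4` brings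
its weight to `7`. -/
def cubicForm (i a b c : Fin 3) (p : MvPolynomial (Fin 3) R) (z : Fin 3 → Jet R) :
    MvPolynomial (Fin 3) R :=
  (z i).der 0 ^ 4 • (vanForm i a z * vanForm i b z * vanForm i c z * p)

/-- A form vanishing to order two at the base point of the jet `z`, corrected by a multiple of the
equation of the tangent line to kill the second derivative along `z`. Its weight is `7`. -/
def quadricForm (i a b : Fin 3) (p : MvPolynomial (Fin 3) R) (z : Fin 3 → Jet R) :
    MvPolynomial (Fin 3) R :=
  (z i).der 0 • ((((z i).der 0 * jetDet z) • (vanForm i a z * vanForm i b z) -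
    (2 * (vanDeriv i a z * vanDeriv i b z)) • (X i * tangentForm z)) * p)

theorem aeval_vanForm (i b : Fin 3) (z : Fin 3 → Jet R) :
    aeval z (vanForm i b z) =
      ⟨![0, vanDeriv i b z, (z i).der 0 * (z b).der 2 - (z b).der 0 * (z i).der 2]⟩ := by
  apply Jet.ext_three <;> simp [vanForm, vanDeriv, mul_comm]

theorem aeval_tangentForm (z : Fin 3 → Jet R) :
    aeval z (tangentForm z) = ⟨![0, 0, jetDet z]⟩ := by
  apply Jet.ext_three <;>
    simp [tangentForm, linForm, jetDet, cross_apply, Fin.sum_univ_three, Matrix.det_fin_three] <;>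
    ring

theorem aeval_cubicForm (i a b c : Fin 3) (p : MvPolynomial (Fin 3) R) (z : Fin 3 → Jet R) :
    aeval z (cubicForm i a b c p z) = 0 := by
  have h : aeval z (vanForm i a z) * aeval z (vanForm i b z) * aeval z (vanForm i c z) = 0 := by
    simp only [aeval_vanForm]
    apply Jet.ext_three <;> simp
  simp only [cubicForm, map_smul, map_mul, h, zero_mul, smul_zero]

theorem aeval_quadricForm (i a b : Fin 3) (p : MvPolynomial (Fin 3) R) (z : Fin 3 → Jet R) :
    aeval z (quadricForm i a b p z) = 0 := by
  have h : ((z i).der 0 * jetDet z) • (aeval z (vanForm i a z) * aeval z (vanForm i b z)) -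
      (2 * (vanDeriv i a z * vanDeriv i b z)) • (z i * aeval z (tangentForm z)) = 0 := by
    simp only [aeval_vanForm, aeval_tangentForm]
    apply Jet.ext_three <;> simp
    ring
  simp only [quadricForm, map_smul, map_mul, map_sub, aeval_X, h, zero_mul, smul_zero]

theorem vanForm_mul_left (i b : Fin 3) (g : Jet R) (z : Fin 3 → Jet R) :
    vanForm i b (fun k => g * z k) = g.der 0 • vanForm i b z := by
  simp [vanForm, smul_sub, smul_smul]

theorem vanDeriv_mul_left (i b : Fin 3) (g : Jet R) (z : Fin 3 → Jet R) :
    vanDeriv i b (fun k => g * z k) = g.der 0 ^ 2 * vanDeriv i b z := by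
  simp only [vanDeriv, Jet.der_mul, Matrix.cons_val]
  ring

theorem jetDet_mul_left (g : Jet R) (z : Fin 3 → Jet R) :
    jetDet (fun k => g * z k) = g.der 0 ^ 3 * jetDet z := by
  simp only [jetDet, Jet.der_mul, Matrix.det_fin_three, Matrix.of_apply, Matrix.cons_val]
  ring

theorem tangentForm_mul_left (g : Jet R) (z : Fin 3 → Jet R) :
    tangentForm (fun k => g * z k) = g.der 0 ^ 2 • tangentForm z := by
  simp only [tangentForm, linForm, Jet.der_mul, cross_apply, Fin.sum_univ_three, Matrix.cons_val,
    smul_eq_C_mul, C_sub, C_add, C_mul, C_pow]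
  ring

theorem cubicForm_mul_left (i a b c : Fin 3) (p : MvPolynomial (Fin 3) R) (g : Jet R)
    (z : Fin 3 → Jet R) :
    cubicForm i a b c p (fun k => g * z k) = g.der 0 ^ 7 • cubicForm i a b c p z := by
  simp only [cubicForm, vanForm_mul_left, Jet.der_mul, Matrix.cons_val, smul_eq_C_mul, map_mul,
    map_pow]
  ring

theorem quadricForm_mul_left (i a b : Fin 3) (p : MvPolynomial (Fin 3) R) (g : Jet R)
    (z : Fin 3 → Jet R) :
    quadricForm i a b p (fun k => g * z k) = g.der 0 ^ 7 • quadricForm i a b p z := by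
  simp only [quadricForm, vanForm_mul_left, vanDeriv_mul_left, jetDet_mul_left,
    tangentForm_mul_left, Jet.der_mul, Matrix.cons_val, smul_eq_C_mul, map_mul, map_pow]
  ring

theorem isHomogeneous_vanForm (i b : Fin 3) (z : Fin 3 → Jet R) :
    (vanForm i b z).IsHomogeneous 1 := by
  simp only [vanForm, smul_eq_C_mul]
  exact (isHomogeneous_C_mul_X _ b).sub (isHomogeneous_C_mul_X _ i)

theorem isHomogeneous_cubicForm (i a b c : Fin 3) {p : MvPolynomial (Fin 3) R} {k : ℕ}
    (hp : p.IsHomogeneous k) (z : Fin 3 → Jet R) :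
    (cubicForm i a b c p z).IsHomogeneous (3 + k) := by
  rw [cubicForm, smul_eq_C_mul]
  exact ((((isHomogeneous_vanForm i a z).mul (isHomogeneous_vanForm i b z)).mul
    (isHomogeneous_vanForm i c z)).mul hp).C_mul _

theorem isHomogeneous_quadricForm (i a b : Fin 3) {p : MvPolynomial (Fin 3) R} {k : ℕ}
    (hp : p.IsHomogeneous k) (z : Fin 3 → Jet R) :
    (quadricForm i a b p z).IsHomogeneous (2 + k) := by
  simp only [quadricForm, smul_eq_C_mul]
  exact (((((isHomogeneous_vanForm i a z).mul (isHomogeneous_vanForm i b z)).C_mul _).sub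
    (((isHomogeneous_X R i).mul (isHomogeneous_linForm _)).C_mul _)).mul hp).C_mul _

end Definitions

section PolynomialDependence

variable (j : Fin 3)

theorem der_chartJet_mem_polyMaps (k o : Fin 3) :
    (fun x => (chartJet j x k).der o) ∈ polyMaps d 0 ℂ :=
  polyMaps.der (chartJet_mem_polyMaps j k) o

theorem vanForm_mem_polyMaps (i b : Fin 3) :
    (fun x => vanForm i b (chartJet j x)) ∈ polyMaps d 0 (MvPolynomial (Fin 3) ℂ) :=
  Submodule.sub_mem _
    (polyMaps.zero_smul (der_chartJet_mem_polyMaps j i 0) (polyMaps.const 0 (X b)))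
    (polyMaps.zero_smul (der_chartJet_mem_polyMaps j b 0) (polyMaps.const 0 (X i)))

theorem vanDeriv_mem_polyMaps (i b : Fin 3) :
    (fun x => vanDeriv i b (chartJet j x)) ∈ polyMaps d 0 ℂ :=
  Submodule.sub_mem _
    (polyMaps.zero_mul (der_chartJet_mem_polyMaps j i 0) (der_chartJet_mem_polyMaps j b 1))
    (polyMaps.zero_mul (der_chartJet_mem_polyMaps j b 0) (der_chartJet_mem_polyMaps j i 1))

theorem cross_mem_polyMaps (k : Fin 3) :
    (fun x => ((fun l => (chartJet j x l).der 0) ⨯₃ fun l => (chartJet j x l).der 1) k) ∈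
      polyMaps d 0 ℂ := by
  have hminor (l m : Fin 3) : (fun x => (chartJet j x l).der 0 * (chartJet j x m).der 1 -
      (chartJet j x m).der 0 * (chartJet j x l).der 1) ∈ polyMaps d 0 ℂ :=
    vanDeriv_mem_polyMaps j l m
  simp only [cross_apply]
  fin_cases k
  exacts [hminor 1 2, hminor 2 0, hminor 0 1]

theorem tangentForm_mem_polyMaps :
    (fun x => tangentForm (chartJet j x)) ∈ polyMaps d 0 (MvPolynomial (Fin 3) ℂ) := by
  simp only [tangentForm, linForm, ← smul_eq_C_mul]
  exact polyMaps.sum fun k =>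
    polyMaps.zero_smul (cross_mem_polyMaps j k) (polyMaps.const 0 (X k))

theorem jetDet_mem_polyMaps : (fun x => jetDet (chartJet j x)) ∈ polyMaps d 0 ℂ := by
  have hdet := polyMaps.sum fun k =>
    polyMaps.zero_mul (cross_mem_polyMaps (d := d) j k) (der_chartJet_mem_polyMaps j k 2)
  convert hdet using 2 with x
  simp only [jetDet, cross_apply, Fin.sum_univ_three, Matrix.det_fin_three, Matrix.of_apply,
    Matrix.cons_val]
  ring

theorem isVanishingForm_cubicForm (i a b c : Fin 3) {p : MvPolynomial (Fin 3) ℂ} {k : ℕ}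
    (hk : 3 + k = d) (hp : p.IsHomogeneous k) : IsVanishingForm d 7 (cubicForm i a b c p) where
  poly j := polyMaps.zero_smul (polyMaps.pow (der_chartJet_mem_polyMaps j i 0) 4)
    (polyMaps.zero_mul (polyMaps.zero_mul (polyMaps.zero_mul (vanForm_mem_polyMaps j i a)
      (vanForm_mem_polyMaps j i b)) (vanForm_mem_polyMaps j i c)) (polyMaps.const 0 p))
  isHomogeneous z := hk ▸ isHomogeneous_cubicForm i a b c hp z
  aeval_eq_zero := aeval_cubicForm i a b c p
  mul_left := cubicForm_mul_left i a b c p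

theorem isVanishingForm_quadricForm (i a b : Fin 3) {p : MvPolynomial (Fin 3) ℂ} {k : ℕ}
    (hk : 2 + k = d) (hp : p.IsHomogeneous k) : IsVanishingForm d 7 (quadricForm i a b p) where
  poly j := by
    have hi := der_chartJet_mem_polyMaps (d := d) j i 0
    have hsquare := polyMaps.zero_smul (polyMaps.zero_mul hi (jetDet_mem_polyMaps j))
      (polyMaps.zero_mul (vanForm_mem_polyMaps j i a) (vanForm_mem_polyMaps j i b))
    have hcorrection := polyMaps.zero_smul (d := d)
      (polyMaps.zero_mul (polyMaps.const 0 2)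
        (polyMaps.zero_mul (vanDeriv_mem_polyMaps j i a) (vanDeriv_mem_polyMaps j i b)))
      (polyMaps.zero_mul (polyMaps.const 0 (X i)) (tangentForm_mem_polyMaps j))
    exact polyMaps.zero_smul hi
      (polyMaps.zero_mul (Submodule.sub_mem _ hsquare hcorrection) (polyMaps.const 0 p))
  isHomogeneous z := hk ▸ isHomogeneous_quadricForm i a b hp z
  aeval_eq_zero := aeval_quadricForm i a b p
  mul_left := quadricForm_mul_left i a b p

end PolynomialDependence

end VanishingForms

section Spanning

theorem mul_mem_of_isHomogeneous {K σ : Type*} [Field K] [CharZero K] [Finite σ]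
    {T : Submodule K (MvPolynomial σ K)} (i : σ) (t : σ → K) {m : ℕ} {q p : MvPolynomial σ K}
    (hpow : q * X i ^ m ∈ T)
    (hmul : ∀ b k r, k + 1 = m → r.IsHomogeneous k → q * (X b - t b • X i) * r ∈ T)
    (hp : p.IsHomogeneous m) : q * p ∈ T := by
  cases nonempty_fintype σ
  induction m generalizing q p with
  | zero =>
    rw [totalDegree_eq_zero_iff_eq_C.1 ((totalDegree_zero_iff_isHomogeneous _).2 hp), mul_comm,
      ← smul_eq_C_mul]
    exact T.smul_mem _ (by simpa only [pow_zero, mul_one] using hpow)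
  | succ m ih =>
    have hX {r : MvPolynomial σ K} (hr : r.IsHomogeneous m) : q * X i * r ∈ T := by
      refine ih (by rwa [mul_assoc, ← pow_succ']) (fun b k s hk hs => ?_) hr
      have hXs : (X i * s).IsHomogeneous (k + 1) := add_comm 1 k ▸ (isHomogeneous_X K i).mul hs
      rw [mul_right_comm q, mul_assoc]
      exact hmul b (k + 1) (X i * s) (by omega) hXs
    have heuler : ((m + 1 : ℕ) : K) • (q * p) = ∑ b, q * (X b * pderiv b p) := by
      rw [← Finset.mul_sum, hp.sum_X_mul_pderiv, ← Nat.cast_smul_eq_nsmul K, mul_smul_comm]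
    rw [← T.smul_mem_iff (Nat.cast_ne_zero.2 m.succ_ne_zero : ((m + 1 : ℕ) : K) ≠ 0), heuler]
    refine T.sum_mem fun b _ => ?_
    have hpderiv : (pderiv b p).IsHomogeneous m := hp.pderiv
    have hsplit : q * (X b * pderiv b p) =
        q * (X b - t b • X i) * pderiv b p + t b • (q * X i * pderiv b p) := by
      simp only [smul_eq_C_mul]
      ring
    rw [hsplit]
    exact T.add_mem (hmul b m _ rfl hpderiv) (T.smul_mem _ (hX hpderiv))

theorem exists_eq_linForm {R : Type*} [CommRing R] {p : MvPolynomial (Fin 3) R}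
    (hp : p.IsHomogeneous 1) : ∃ c, p = linForm c := by
  refine ⟨fun k => coeff 0 (pderiv k p), ?_⟩
  have heuler : p = ∑ k, X k * pderiv k p := by rw [hp.sum_X_mul_pderiv, one_nsmul]
  refine heuler.trans (Finset.sum_congr rfl fun k _ => ?_)
  have hconst : (pderiv k p).totalDegree = 0 :=
    (totalDegree_zero_iff_isHomogeneous _).2 hp.pderiv
  rw [mul_comm, ← totalDegree_eq_zero_iff_eq_C.1 hconst]

theorem der_aeval_linForm {R : Type*} [CommRing R] (z : Fin 3 → Jet R) (c : Fin 3 → R)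
    (o : Fin 3) : (aeval z (linForm c)).der o = ∑ k, (z k).der o * c k := by
  simp only [linForm, map_sum, map_mul, aeval_C, aeval_X, ← Algebra.smul_def, Jet.der_sum,
    Jet.der_smul, Pi.smul_apply, smul_eq_mul, mul_comm (c _)]

theorem linForm_eq_zero_of_aeval_eq_zero {R : Type*} [CommRing R] [IsDomain R]
    {z : Fin 3 → Jet R} (hz : jetDet z ≠ 0) {c : Fin 3 → R} (h : aeval z (linForm c) = 0) :
    linForm c = 0 := by
  have hc : c = 0 := by
    refine Matrix.eq_zero_of_mulVec_eq_zero hz (funext fun o => ?_)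
    exact (der_aeval_linForm z c o).symm.trans (congrArg (fun g : Jet R => g.der o) h)
  simp only [hc, linForm, Pi.zero_apply, map_zero, zero_mul, Finset.sum_const_zero]

/-- The span of the values at the jet `z` of the vanishing forms of weight `c`. -/
def vanishingForms (d c : ℕ) (z : Fin 3 → Jet ℂ) : Submodule ℂ (MvPolynomial (Fin 3) ℂ) :=
  Submodule.span ℂ {p | ∃ Q, IsVanishingForm d c Q ∧ Q z = p}

theorem aeval_eq_zero_of_mem_vanishingForms {c : ℕ} {z : Fin 3 → Jet ℂ}
    {p : MvPolynomial (Fin 3) ℂ} (hp : p ∈ vanishingForms d c z) : aeval z p = 0 := by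
  have hle : vanishingForms d c z ≤ LinearMap.ker (aeval (R := ℂ) z).toLinearMap := by
    refine Submodule.span_le.2 ?_
    rintro _ ⟨Q, hQ, rfl⟩
    exact hQ.aeval_eq_zero z
  exact hle hp

theorem paramVec_coeffVec_mem_sectionValues {c : ℕ} {i : Fin 3} {x : Coord d → ℂ}
    {p : MvPolynomial (Fin 3) ℂ} (hp : p ∈ vanishingForms d c (chartJet i x)) :
    paramVec d (coeffVec d p) ∈ sectionValues c 0 i x := by
  have hle : vanishingForms d c (chartJet i x) ≤
      (sectionValues c 0 i x).comap (paramVec d ∘ₗ coeffVec d) := by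
    refine Submodule.span_le.2 ?_
    rintro _ ⟨Q, hQ, rfl⟩
    exact ⟨_, hQ.isSection, rfl⟩
  exact hle hp

/-- The multiples by `X_i ^ n` of the linear forms. -/
def powMulLinForms (i : Fin 3) (n : ℕ) : Submodule ℂ (MvPolynomial (Fin 3) ℂ) :=
  (homogeneousSubmodule (Fin 3) ℂ 1).map (LinearMap.mulLeft ℂ (X i ^ n))

section

variable {i : Fin 3} {z : Fin 3 → Jet ℂ}

theorem vanForm_mul_vanForm_mul_pow_mem (hi : z i = 1) (hz : jetDet z ≠ 0) (a b : Fin 3) {k : ℕ}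
    (hk : 2 + k = d) :
    vanForm i a z * vanForm i b z * X i ^ k ∈
      vanishingForms d 7 z ⊔ powMulLinForms i (d - 1) := by
  set T := vanishingForms d 7 z ⊔ powMulLinForms i (d - 1)
  have hquadric : quadricForm i a b (X i ^ k) z ∈ T := Submodule.mem_sup_left
    (Submodule.subset_span ⟨_, isVanishingForm_quadricForm i a b hk (isHomogeneous_X_pow i k), rfl⟩)
  have htangent : X i ^ (d - 1) * tangentForm z ∈ T := Submodule.mem_sup_right
    ⟨_, isHomogeneous_linForm _, rfl⟩
  have hsum := T.add_mem hquadric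
    (T.smul_mem (2 * (vanDeriv i a z * vanDeriv i b z)) htangent)
  rw [← T.smul_mem_iff hz]
  convert hsum using 1
  obtain rfl : d = k + 1 + 1 := by omega
  simp only [quadricForm, hi, Jet.der_one, Matrix.cons_val, one_smul, one_mul, smul_eq_C_mul,
    Nat.add_sub_cancel]
  ring

theorem mem_vanishingForms_sup_powMulLinForms (hd : 1 ≤ d) (hi : z i = 1) (hz : jetDet z ≠ 0)
    {p : MvPolynomial (Fin 3) ℂ} (hp : p.IsHomogeneous d) :
    p ∈ vanishingForms d 7 z ⊔ powMulLinForms i (d - 1) := by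
  set T := vanishingForms d 7 z ⊔ powMulLinForms i (d - 1)
  have hvan (b : Fin 3) : X b - (z b).der 0 • X i = vanForm i b z := by
    simp only [vanForm, hi, Jet.der_one, Matrix.cons_val, one_smul]
  have hlin {n : ℕ} (hn : n + 1 = d) {q : MvPolynomial (Fin 3) ℂ} (hq : q.IsHomogeneous 1) :
      X i ^ n * q ∈ T := by
    obtain rfl : n = d - 1 := by omega
    exact Submodule.mem_sup_right ⟨q, hq, rfl⟩
  have hcubic (a b c : Fin 3) (k : ℕ) (r : MvPolynomial (Fin 3) ℂ) (hk : 3 + k = d)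
      (hr : r.IsHomogeneous k) : vanForm i a z * vanForm i b z * vanForm i c z * r ∈ T := by
    refine Submodule.mem_sup_left
      (Submodule.subset_span ⟨_, isVanishingForm_cubicForm i a b c hk hr, ?_⟩)
    simp only [cubicForm, hi, Jet.der_one, Matrix.cons_val, one_pow, one_smul]
  have hquadric (a b : Fin 3) (k : ℕ) (r : MvPolynomial (Fin 3) ℂ) (hk : 2 + k = d)
      (hr : r.IsHomogeneous k) : vanForm i a z * vanForm i b z * r ∈ T := by
    refine mul_mem_of_isHomogeneous i (fun b => (z b).der 0)
      (vanForm_mul_vanForm_mul_pow_mem hi hz a b hk) (fun c l s hl hs => ?_) hr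
    rw [hvan]
    exact hcubic a b c l s (by omega) hs
  have hlinear (a : Fin 3) (k : ℕ) (r : MvPolynomial (Fin 3) ℂ) (hk : k + 1 = d)
      (hr : r.IsHomogeneous k) : vanForm i a z * r ∈ T := by
    refine mul_mem_of_isHomogeneous i (fun b => (z b).der 0) ?_ (fun b l s hl hs => ?_) hr
    · rw [mul_comm]
      exact hlin hk (isHomogeneous_vanForm i a z)
    · rw [hvan]
      exact hquadric a b l s (by omega) hs
  rw [← one_mul p]
  refine mul_mem_of_isHomogeneous i (fun b => (z b).der 0) ?_ (fun a k r hk hr => ?_) hp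
  · rw [one_mul, ← Nat.sub_add_cancel hd, pow_succ]
    exact hlin (Nat.sub_add_cancel hd) (isHomogeneous_X ℂ i)
  · rw [one_mul, hvan]
    exact hlinear a k r hk hr

theorem mem_vanishingForms_of_aeval_eq_zero (hd : 1 ≤ d) (hi : z i = 1) (hz : jetDet z ≠ 0)
    {p : MvPolynomial (Fin 3) ℂ} (hp : p.IsHomogeneous d) (h : aeval z p = 0) :
    p ∈ vanishingForms d 7 z := by
  obtain ⟨q, hq, _, ⟨l, hl, rfl⟩, rfl⟩ :=
    Submodule.mem_sup.1 (mem_vanishingForms_sup_powMulLinForms hd hi hz hp)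
  obtain ⟨c, rfl⟩ := exists_eq_linForm hl
  have hc : aeval z (linForm c) = 0 := by
    simpa only [LinearMap.mulLeft_apply, map_add, map_mul, map_pow, aeval_X, hi, one_pow, one_mul,
      aeval_eq_zero_of_mem_vanishingForms hq, zero_add] using h
  rwa [linForm_eq_zero_of_aeval_eq_zero hz hc, map_zero, add_zero]

end

variable {i : Fin 3} {x v : Coord d → ℂ}

theorem paramVec_mem_sectionValues (hd : 1 ≤ d) (hW : jetDet (chartJet i x) ≠ 0) {b : Idx d → ℂ}
    (hb : paramVec d b ∈ tangentSpace i x) : paramVec d b ∈ sectionValues 7 0 i x := by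
  rw [paramVec_mem_tangentSpace_iff] at hb
  rw [← coeffVec_form b]
  exact paramVec_coeffVec_mem_sectionValues
    (mem_vanishingForms_of_aeval_eq_zero hd (chartJet_self i x) hW (form_isHomogeneous b) hb)

theorem exists_aeval_linForm_eq {R : Type*} [CommRing R] {z : Fin 3 → Jet R}
    (hz : IsUnit (jetDet z)) (y : Fin 3 → Jet R) :
    ∃ M : Matrix (Fin 3) (Fin 3) R, ∀ k, aeval z (linForm (M k)) = y k := by
  set J : Matrix (Fin 3) (Fin 3) R := Matrix.of fun o k => (z k).der o
  set Y : Matrix (Fin 3) (Fin 3) R := Matrix.of fun o k => (y k).der o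
  have hmul : J * (J⁻¹ * Y) = Y := by rw [← mul_assoc, Matrix.mul_nonsing_inv J hz, one_mul]
  refine ⟨(J⁻¹ * Y).transpose, fun k => ?_⟩
  have hder (o : Fin 3) : (aeval z (linForm ((J⁻¹ * Y).transpose k))).der o = (y k).der o := by
    rw [der_aeval_linForm]
    exact congrFun (congrFun hmul o) k
  exact Jet.ext_three (hder 0) (hder 1) (hder 2)

/-- The scaling `(v Z₃)/Z₃` imposed by the tangent vector `v`, as a jet. -/
def logDerivJet (x v : Coord d → ℂ) : Jet ℂ := ⟨![v (.l 0) / x (.l 0), v (.l 1), v (.l 2)]⟩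

theorem exists_sub_glField_eq_paramVec (hW : jetDet (chartJet i x) ≠ 0) (hl : x (.l 0) ≠ 0)
    (v : Coord d → ℂ) : ∃ M b, v - glField M i x = paramVec d b := by
  obtain ⟨M, hM⟩ := exists_aeval_linForm_eq hW.isUnit fun k =>
    dChartJet i v k - logDerivJet x v * chartJet i x k
  have hMi : aeval (chartJet i x) (linForm (M i)) = -logDerivJet x v := by
    rw [hM, dChartJet_self, chartJet_self, mul_one, zero_sub]
  have hw (k : Fin 3) : dChartJet i (glField M i x) k = dChartJet i v k := by
    rw [dChartJet_glField, hMi, hM]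
    ring
  refine ⟨M, coeffs (v - glField M i x), sub_eq_iff_eq_add'.2 (funext fun c => ?_)⟩
  rcases c with ⟨o, k⟩ | o | α
  · have hwk := congrArg (fun g : Jet ℂ => g.der o) (hw (i.succAbove k))
    simp only [dChartJet_succAbove] at hwk
    simpa [paramVec] using hwk.symm
  · fin_cases o <;> simp [paramVec, glField, hMi, logDerivJet, hl]
  · exact (add_sub_cancel _ _).symm

theorem mem_sectionValues (hd : 1 ≤ d) (hx : x ∈ jetChart d i) (hW : jetDet (chartJet i x) ≠ 0)
    (hl : x (.l 0) ≠ 0) (hv : v ∈ tangentSpace i x) : v ∈ sectionValues 7 1 i x := by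
  obtain ⟨M, b, hb⟩ := exists_sub_glField_eq_paramVec hW hl v
  have htangent : paramVec d b ∈ tangentSpace i x :=
    hb ▸ sub_mem hv ((isSection_glField M).tangent i x hx)
  obtain ⟨V, hV, hVb⟩ := paramVec_mem_sectionValues hd hW htangent
  refine ⟨_, ((isSection_glField M).mul_pow i 7).add (.mono zero_le_one hV), ?_⟩
  rw [hVb, ← hb, homJet_zero_self, one_pow, one_smul, add_sub_cancel]

end Spanning

section WronskianLocus

theorem jetDet_chartJet (i : Fin 3) (x : Coord d → ℂ) :
    jetDet (chartJet i x) = (-1) ^ (i : ℕ) * wronskian x := by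
  have hcol (o : Fin 3) : (chartJet i x i).der o = if o = 0 then 1 else 0 := by
    rw [chartJet_self]
    fin_cases o <;> rfl
  rw [jetDet, Matrix.det_succ_column _ i, Fin.sum_univ_three]
  simp [hcol, wronskian, Matrix.det_fin_two, -chartJet_self]

theorem jetDet_chartJet_eq_zero_iff {i : Fin 3} {x : Coord d → ℂ} :
    jetDet (chartJet i x) = 0 ↔ wronskian x = 0 := by
  rw [jetDet_chartJet, mul_eq_zero, or_iff_right (pow_ne_zero _ (neg_ne_zero.2 one_ne_zero))]

theorem wronskian_transition_eq_zero {i j : Fin 3} {x : Coord d → ℂ} (h : homJet i x 0 j ≠ 0)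
    (hW : wronskian x = 0) : wronskian (transition d i j x) = 0 := by
  have hz : (fun k => chartJet i x j * chartJet j (transition d i j x) k) = chartJet i x :=
    funext fun k => by rw [mul_comm, chartJet_transition h]
  have hdet := jetDet_mul_left (chartJet i x j) (chartJet j (transition d i j x))
  rw [hz, jetDet_chartJet_eq_zero_iff.2 hW] at hdet
  exact jetDet_chartJet_eq_zero_iff.1
    ((mul_eq_zero.1 hdet.symm).resolve_left (pow_ne_zero 3 h))

theorem ofChart_mem_of_wronskian_eq_zero {i : Fin 3} (x : jetChart d i)
    (h : homJet i x.1 0 0 ≠ 0) (hW : wronskian x.1 = 0) :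
    ofChart i x ∈ {q | ∃ y : jetChart d 0, q = ofChart 0 y ∧ wronskian y.1 = 0} :=
  ⟨⟨_, transition_mem_jetChart h x.2⟩, Quot.sound ⟨h, rfl⟩, wronskian_transition_eq_zero h hW⟩

section ShearSubst

variable {R : Type*} [CommRing R] {i j : Fin 3}

/-- The substitution `X_j ↦ X_j - s X_i`. -/
def shearSubst (i j : Fin 3) (s : R) : MvPolynomial (Fin 3) R →ₐ[R] MvPolynomial (Fin 3) R :=
  aeval fun m => X m - C (if m = j then s else 0) * X i

theorem isHomogeneous_shearSubst (s : R) {p : MvPolynomial (Fin 3) R} {n : ℕ}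
    (hp : p.IsHomogeneous n) : (shearSubst i j s p).IsHomogeneous n := by
  rw [← one_mul n, shearSubst]
  exact hp.aeval _ fun m => (isHomogeneous_X R m).sub (isHomogeneous_C_mul_X _ i)

theorem aeval_shearSubst {A : Type*} [CommRing A] [Algebra R A] (s : R) {z y : Fin 3 → A}
    (hy : ∀ m, y m = z m + algebraMap R A (if m = j then s else 0) * y i)
    (p : MvPolynomial (Fin 3) R) : aeval y (shearSubst i j s p) = aeval z p := by
  have hcomp : (aeval y).comp (shearSubst i j s) = aeval z := by
    ext m
    simp only [shearSubst, AlgHom.comp_apply, aeval_X, map_sub, map_mul, aeval_C,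
      sub_eq_iff_eq_add.2 (hy m)]
  exact DFunLike.congr_fun hcomp p

theorem shearSubst_zero (p : MvPolynomial (Fin 3) R) : shearSubst i j 0 p = p := by
  simp only [shearSubst, ite_self, map_zero, zero_mul, sub_zero]
  exact aeval_X_left_apply p

theorem shearSubst_neg_shearSubst (hij : i ≠ j) (s : R) (p : MvPolynomial (Fin 3) R) :
    shearSubst i j (-s) (shearSubst i j s p) = p := by
  rw [shearSubst, aeval_shearSubst (z := X), aeval_X_left_apply]
  intro m
  rw [if_neg hij, algebraMap_eq, map_zero, zero_mul, sub_zero]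
  split_ifs <;> simp

theorem map_shearSubst {S : Type*} [CommRing S] (f : R →+* S) (s : R)
    (p : MvPolynomial (Fin 3) R) :
    map f (shearSubst i j s p) = shearSubst i j (f s) (map f p) := by
  induction p using MvPolynomial.induction_on with
  | C a => simp only [algHom_C, algebraMap_eq, map_C]
  | add p q hp hq => simp only [map_add, hp, hq]
  | mul_X p m hp =>
    have hcoeff : f (if m = j then s else 0) = if m = j then f s else 0 := by
      rw [apply_ite f, map_zero]
    have hX : map f (shearSubst i j s (X m)) = shearSubst i j (f s) (X m) := by
      simp only [shearSubst, aeval_X, map_sub, map_mul, map_X, map_C, hcoeff]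
    rw [map_mul, map_mul, map_mul, map_mul, hp, hX, map_X]

theorem continuous_coeff_shearSubst [TopologicalSpace R] [IsTopologicalRing R]
    (p : MvPolynomial (Fin 3) R) (n : Fin 3 →₀ ℕ) :
    Continuous fun s => coeff n (shearSubst i j s p) := by
  have heval (s : R) : shearSubst i j s p =
      map (Polynomial.evalRingHom s) (shearSubst i j Polynomial.X (map Polynomial.C p)) := by
    have hid : (Polynomial.evalRingHom s).comp Polynomial.C = RingHom.id R := by
      ext a
      simp only [RingHom.comp_apply, Polynomial.coe_evalRingHom, Polynomial.eval_C,
        RingHom.id_apply]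
    rw [map_shearSubst, map_map, hid, map_id, Polynomial.coe_evalRingHom, Polynomial.eval_X]
  simp only [heval, coeff_map]
  exact Polynomial.continuous _

end ShearSubst

/-- The image of a log jet under the linear substitution `Z_j ↦ Z_j + s Z_i` of `ℙ²`, with
`j = i.succAbove k`, in the chart `Z_i ≠ 0`. -/
def shear (i : Fin 3) (k : Fin 2) (s : ℂ) (x : Coord d → ℂ) : Coord d → ℂ
  | .w o l => x (.w o l) + if o = 0 ∧ l = k then s else 0
  | .l o => x (.l o)
  | .a α => coeffVec d (shearSubst i (i.succAbove k) s (form (coeffs x))) α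

section Shear

variable (i : Fin 3) (k : Fin 2) (s : ℂ) (x : Coord d → ℂ)

theorem chartJet_shear (m : Fin 3) :
    chartJet i (shear i k s x) m =
      chartJet i x m + algebraMap ℂ (Jet ℂ) (if m = i.succAbove k then s else 0) := by
  rcases Fin.eq_self_or_eq_succAbove i m with rfl | ⟨l, rfl⟩
  · rw [chartJet_self, chartJet_self, if_neg (Fin.succAbove_ne m k).symm, map_zero, add_zero]
  · simp only [chartJet_succAbove, Fin.succAbove_right_inj]
    apply Jet.ext_three <;> simp [shear]

theorem form_coeffs_shear :
    form (coeffs (shear i k s x)) = shearSubst i (i.succAbove k) s (form (coeffs x)) :=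
  form_coeffVec (isHomogeneous_shearSubst s (form_isHomogeneous _))

theorem eqnsJet_shear : eqnsJet i (shear i k s x) = eqnsJet i x := by
  rw [eqnsJet, form_coeffs_shear, aeval_shearSubst s (z := chartJet i x)]
  · rfl
  · intro m
    rw [chartJet_self, mul_one, chartJet_shear]

theorem form_zero : form (0 : Idx d → ℂ) = 0 := by
  simp only [form_eq_sum_monomial, Pi.zero_apply, map_zero, Finset.sum_const_zero]

theorem coeffs_shear_ne_zero (hx : coeffs x ≠ 0) : coeffs (shear i k s x) ≠ 0 := fun h => hx <| by
  have hform : form (coeffs x) = 0 := by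
    rw [← shearSubst_neg_shearSubst (Fin.succAbove_ne i k).symm s (form (coeffs x)),
      ← form_coeffs_shear, h, form_zero, map_zero]
  rw [← coeffVec_form (coeffs x), hform, map_zero]

theorem shear_mem_jetChart (hx : x ∈ jetChart d i) : shear i k s x ∈ jetChart d i :=
  ⟨coeffs_shear_ne_zero i k s x hx.1, by
    rw [eqns_eq_zero_iff, eqnsJet_shear, ← eqns_eq_zero_iff]
    exact hx.2⟩

theorem wronskian_shear : wronskian (shear i k s x) = wronskian x := by
  simp [wronskian, shear]

theorem shear_zero : shear i k 0 x = x := by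
  funext c
  rcases c with ⟨o, l⟩ | o | α
  · simp [shear]
  · rfl
  · rw [shear, shearSubst_zero, coeffVec_form, coeffs]

theorem continuous_shear : Continuous fun s => shear i k s x := by
  refine continuous_pi fun c => ?_
  rcases c with ⟨o, l⟩ | o | α
  · exact continuous_const.add (continuous_if_const _ (fun _ => continuous_id) fun _ =>
      continuous_const)
  · exact continuous_const
  · exact continuous_coeff_shearSubst _ _

end Shear

theorem continuous_ofChart (i : Fin 3) : Continuous (ofChart (d := d) i) :=
  continuous_quot_mk.comp continuous_sigmaMk

theorem mem_wronskianLocus {i : Fin 3} (x : jetChart d i) (hW : wronskian x.1 = 0) :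
    ofChart i x ∈ wronskianLocus d := by
  by_cases h : homJet i x.1 0 0 = 0
  swap
  · exact subset_closure (ofChart_mem_of_wronskian_eq_zero x h hW)
  obtain ⟨k, hk⟩ : ∃ k, 0 = i.succAbove k :=
    (Fin.eq_self_or_eq_succAbove i 0).resolve_left <| by
      rintro rfl
      exact one_ne_zero ((homJet_zero_self 0 x.1).symm.trans h)
  let γ (s : ℂ) : jetChart d i := ⟨shear i k s x.1, shear_mem_jetChart i k s x.1 x.2⟩
  have hγ : Continuous γ := (continuous_shear i k x.1).subtype_mk _
  have hγ0 : γ 0 = x := Subtype.ext (shear_zero i k x.1)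
  rw [← hγ0]
  refine map_mem_closure (f := fun s => ofChart i (γ s)) (s := {0}ᶜ)
    ((continuous_ofChart i).comp hγ) (dense_compl_singleton (0 : ℂ) 0) fun s hs =>
      ofChart_mem_of_wronskian_eq_zero _ ?_ ((wronskian_shear i k s x.1).trans hW)
  have hZ₀ : (chartJet i (shear i k s x.1) 0).der 0 = s := by
    rw [chartJet_shear, if_pos hk]
    simp [chartJet, h]
  exact hZ₀.trans_ne hs

theorem proj_mem_divH {i : Fin 3} (x : jetChart d i) (hl : x.1 (.l 0) = 0) :
    proj d (ofChart i x) ∈ divH d := by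
  obtain ⟨t, ht⟩ := Projectivization.exists_smul_eq_mk_rep ℂ (homPt i x.1) (homPt_ne_zero i x.1)
  change (Projectivization.mk ℂ (homPt i x.1) (homPt_ne_zero i x.1)).rep 3 = 0
  rw [← ht]
  change (t : ℂ) * homPt i x.1 3 = 0
  rw [homPt_three, hl, mul_zero]

end WronskianLocus

end LogJets

end

theorem mainTheorem3 (d : ℕ) (hd : 1 ≤ d) :
    ∃ e : ℕ, ∀ (i : Fin 3) (x : LogJets.jetChart d i),
      LogJets.ofChart i x ∉ LogJets.wronskianLocus d ∪ LogJets.proj d ⁻¹' LogJets.divH d →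
      ∀ v ∈ LogJets.tangentSpace i x.1,
        ∃ s : LogJets.GlobalSection d 7 e, s.value i x.1 = v := by
  refine ⟨1, fun i x hx v hv => ?_⟩
  have hl : x.1 (.l 0) ≠ 0 := fun h => hx (Or.inr (LogJets.proj_mem_divH x h))
  have hW : LogJets.jetDet (LogJets.chartJet i x.1) ≠ 0 := fun h =>
    hx (Or.inl (LogJets.mem_wronskianLocus x (LogJets.jetDet_chartJet_eq_zero_iff.1 h)))
  obtain ⟨V, hV, rfl⟩ := LogJets.mem_sectionValues hd x.2 hW hl hv
  obtain ⟨s, hs⟩ := hV.exists_globalSection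
  exact ⟨s, hs i x.1⟩
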